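/- Let $N=\{1,\dots,n\}$ ($n\ge 1$) be agents, $G$ a finite set of goods, $c\ge 2$ an integer. Every agent $i$ has a $(1,c)$-bivalued submodular valuation $v_i$ on $2^G$: $v_i(\emptyset)=0$; $\Delta_i(S,g):=v_i(S\cup\{g\})-v_i(S)\in\{1,c\}$ for $g\notin S$; and $\Delta_i(S,g)\ge\Delta_i(T,g)$ for $S\subseteq T$, $g\notin T$. An allocation $X=(X_0,X_1,\dots,X_n)$ is a partition of $G$ into possibly empty bundles, $X_0$ being the unallocated goods; its utility vector is $\vec u^X=(v_i(X_i))_{i\in N}$. The dummy agent $0$ has $v_0(S)=c|S|$. For $i\in N\cup\{0\}$ put $\beta_i(S)=\max\{|T|:T\subseteq S,\ v_i(T)=c|T|\}$. An allocation $X$ is clean if $\beta_i(X_i)=|X_i|$ for all $i\in N\cup\{0\}$. **Justice criteria.** A justice criterion $\Psi$ is a total preorder $\succeq_\Psi$ on $\mathbb Z_{\ge0}^n$ (reflexive, transitive, any two vectors comparable); $\succ_\Psi$ is its strict part and $x=_\Psi y$ means $x\succeq_\Psi y\succeq_\Psi x$. An allocation $X$ is $\Psi$-maximizing if $\vec u^Y\succ_\Psi\vec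 u^X$ for no allocation $Y$. Write $s(x)$ for $x$ sorted in ascending order. Assume - (C1) if $s(x)_i\ge s(y)_i$ for all $i$, then $x\succeq_\Psi y$, and in this case $x=_\Psi y$ if and only if $s(x)=s(y)$; and let $\varphi$ be a real-valued function of triples $(x,i,d)$, $x\in\mathbb Z_{\ge0}^n$, $i\in N$, $d\in\{1,c\}$, such that for all vectors $x,y\in\mathbb Z^n_{\ge0}$, agents $i,j$ and $d,d_1,d_2\in\{1,c\}$ ($e_i$ being the $i$-th unit vector) - (G1) if $\varphi(x,i,d_1)\ge\varphi(x,j,d_2)$ then $x+d_1e_i\succeq_\Psi x+d_2e_j$, and in this case $x+d_1e_i=_\Psi x+d_2e_j$ if and only if $\varphi(x,i,d_1)=\varphi(x,j,d_2)$; - (G2) if $x_i\le y_i$ then $\varphi(x,i,d)\ge\varphi(y,i,d)$, with equality if $x_i=y_i$; - (G3) if $x_i\le x_j$ then $\varphi(x,i,d)\ge\varphi(x,j,d)$, with equality if and only if $x_i=x_j$. **Domination.** A decomposition of an allocation $X$ consists of a clean allocation $X^c$ and disjoint sets $X^1_1,\dots,X^1_n\subseteq G$ such that, for every $i\in N$,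 $X_i$ is the disjoint union of $X^c_i$ and $X^1_i$, and $|X^c_i|=\beta_i(X_i)$. Let $\succ_{\mathrm{lex}}$ be the strict lexicographic order (at the first differing coordinate the larger entry wins). $X$ dominates $Y$ if for some decompositions of $X$ and $Y$ (which ones is immaterial) either (a) $s(\vec u^{X^c})\succ_{\mathrm{lex}}s(\vec u^{Y^c})$; or (b) $s(\vec u^{X^c})=s(\vec u^{Y^c})$ and $\vec u^{X^c}\succ_{\mathrm{lex}}\vec u^{Y^c}$; or (c) $\vec u^{X^c}=\vec u^{Y^c}$ and $\vec u^{X}\succ_{\mathrm{lex}}\vec u^{Y}$. A dominating $\Psi$-maximizing allocation is a $\Psi$-maximizing allocation that is dominated by no $\Psi$-maximizing allocation. **Bivalued Yankee Swap.** For an allocation $X$, the exchange graph $\mathcal G(X)$ is the directed graph on $G$ with an edge $g\to g'$ whenever $g\in X_j$ and $\beta_j((X_j\setminus\{g\})\cup\{g'\})=\beta_j(X_j)$ for some $j\in N\cup\{0\}$; for $i\in N$ let $F_i(X)=\{g\in G:\beta_i(X_i\cup\{g\})=\beta_i(X_i)+1\}$. Start with $X^c_0=G$, $X^c_i=X^1_i=\emptyset$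 for $i\in N$, and $U=N$. While $\sum_{h\in N}|X^1_h|<|X^c_0|$, let $u$ be the utility vector of the allocation $X^c\cup X^1$ with bundles $X^c_i\cup X^1_i$ ($i\in N$), let $\mathrm{Gain}_c=\max_{k\in U}\varphi(u,k,c)$ and $\mathrm{Gain}_1=\max_{k\in N\setminus U}\varphi(u,k,1)$ (a maximum over the empty set is $-\infty$), and proceed as follows. - If $\mathrm{Gain}_c\ge\mathrm{Gain}_1$, let $i$ be the smallest agent in $U$ attaining $\mathrm{Gain}_c$. If $\mathcal G(X^c)$ has a path from $F_i(X^c)$ to $X^c_0$, choose a shortest such path $(g_1,\dots,g_t)$; give $g_1$ to $i$ and simultaneously, for $1\le s<t$, give $g_{s+1}$ to the agent who held $g_s$ in $X^c$. If $g_t\in X^1_j$ for some $j\in N$, then replace $g_t$ in $X^1_j$ by some good of the new $X^c_0$ that lies in no $X^1_h$. If there is no such path, remove $i$ from $U$. - If $\mathrm{Gain}_c<\mathrm{Gain}_1$, let $i$ be the smallest agent in $N\setminus U$ attaining $\mathrm{Gain}_1$ and add to $X^1_i$ some good of $X^c_0$ that lies in no $X^1_h$. When the loop ends, return $X^c\cup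 X^1$. **Theorem.** However the free choices (shortest paths, unallocated goods) are made, Bivalued Yankee Swap run with $\varphi$ terminates, each of its steps can be carried out, and it returns a dominating $\Psi$-maximizing allocation. -/

import Mathlib

namespace BYS

/-! ### Bivalued submodular valuations

The set of goods is a finite type `G`, the set of agents is `Fin n`.  Valuations with marginals in
`{1, c}`, `c` a natural number, and `v ∅ = 0` only take natural numbers as values. -/

section Valuations

variable {G : Type*} [DecidableEq G]

/-- The marginal utility `v (S + g) - v S` (an integer difference, without truncation). -/
def marginal (v : Finset G → ℕ) (S : Finset G) (g : G) : ℤ :=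
  (v (insert g S) : ℤ) - (v S : ℤ)

/-- `(a, b)`-bivalued submodular valuations. -/
structure IsBivaluedSubmodular (a b : ℕ) (v : Finset G → ℕ) : Prop where
  empty : v ∅ = 0
  marginal_mem : ∀ (S : Finset G) (g : G), g ∉ S →
    marginal v S g = (a : ℤ) ∨ marginal v S g = (b : ℤ)
  submodular : ∀ (S T : Finset G) (g : G), S ⊆ T → g ∉ T → marginal v T g ≤ marginal v S g

/-- `β(S) = max {|T| : T ⊆ S, v(T) = c|T|}`. -/
def beta (c : ℕ) (v : Finset G → ℕ) (S : Finset G) : ℕ :=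
  (S.powerset.filter (fun T => v T = c * T.card)).sup Finset.card

end Valuations

/-! ### Vectors -/

/-- The strict lexicographic order: `y` lexicographically dominates `z`. -/
def LexDom {n : ℕ} (y z : Fin n → ℕ) : Prop :=
  ∃ k : Fin n, (∀ j : Fin n, j < k → y j = z j) ∧ z k < y k

/-- The vector `x` sorted in ascending order. -/
def sorted {n : ℕ} (x : Fin n → ℕ) : Fin n → ℕ := x ∘ Tuple.sort x

/-! ### Justice criteria and gain functions -/

/-- A justice criterion: a total order up to ties (a total preorder) on utility vectors. -/
structure JusticeCriterion (n : ℕ) where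
  /-- `ge x y`: the vector `x` is at least as good as the vector `y`. -/
  ge : (Fin n → ℕ) → (Fin n → ℕ) → Prop
  trans : ∀ x y z, ge x y → ge y z → ge x z
  total : ∀ x y, ge x y ∨ ge y x

namespace JusticeCriterion

variable {n : ℕ}

/-- `x` is strictly better than `y`. -/
def gt (Ψ : JusticeCriterion n) (x y : Fin n → ℕ) : Prop := Ψ.ge x y ∧ ¬ Ψ.ge y x

/-- `x` and `y` are equally good. -/
def equiv (Ψ : JusticeCriterion n) (x y : Fin n → ℕ) : Prop := Ψ.ge x y ∧ Ψ.ge y x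

/-- (C1), symmetric Pareto dominance. -/
def SymmetricParetoDominance (Ψ : JusticeCriterion n) : Prop :=
  ∀ x y : Fin n → ℕ, (∀ i, sorted y i ≤ sorted x i) →
    Ψ.ge x y ∧ (Ψ.equiv x y ↔ sorted x = sorted y)

end JusticeCriterion

/-- The vector resulting from adding `d` to the `i`-th entry of `x`. -/
def addAt {n : ℕ} (x : Fin n → ℕ) (i : Fin n) (d : ℕ) : Fin n → ℕ :=
  Function.update x i (x i + d)

/-- (C2): the real-valued function `φ`, taking a utility vector, an agent and a value `d ∈ {1, c}`,
is a gain function for `Ψ`, i.e. satisfies (G1), (G2) and (G3). -/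
structure IsGainFunction {n : ℕ} (Ψ : JusticeCriterion n) (c : ℕ)
    (φ : (Fin n → ℕ) → Fin n → ℕ → ℝ) : Prop where
  G1 : ∀ (x : Fin n → ℕ) (i j : Fin n) (d₁ d₂ : ℕ), (d₁ = 1 ∨ d₁ = c) → (d₂ = 1 ∨ d₂ = c) →
    φ x j d₂ ≤ φ x i d₁ →
      Ψ.ge (addAt x i d₁) (addAt x j d₂) ∧
        (Ψ.equiv (addAt x i d₁) (addAt x j d₂) ↔ φ x i d₁ = φ x j d₂)
  G2 : ∀ (x y : Fin n → ℕ) (i : Fin n) (d : ℕ), (d = 1 ∨ d = c) → x i ≤ y i →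
    φ y i d ≤ φ x i d ∧ (x i = y i → φ x i d = φ y i d)
  G3 : ∀ (x : Fin n → ℕ) (i j : Fin n) (d : ℕ), (d = 1 ∨ d = c) → x i ≤ x j →
    φ x j d ≤ φ x i d ∧ (φ x i d = φ x j d ↔ x i = x j)

/-! ### Allocations

A partition of `G` into `n + 1` labelled (possibly empty) bundles is given by its labelling
function: `X g = some i` if `g` is in the bundle of agent `i`, and `X g = none` if `g` is in the
bundle of the dummy agent, i.e. unallocated.  A supplementary allocation, a tuple of `n` disjoint
subsets of `G` indexed by the agents, is given in the same way. -/

abbrev Allocation (G : Type*) (n : ℕ) := G → Option (Fin n)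

section Allocations

variable {G : Type*} [Fintype G] [DecidableEq G] {n : ℕ}

/-- The bundle of `k` under `X`; `k = none` is the dummy agent. -/
def bundle (X : Allocation G n) (k : Option (Fin n)) : Finset G :=
  Finset.univ.filter (fun g => X g = k)

/-- The utility vector. -/
def utility (v : Fin n → Finset G → ℕ) (X : Allocation G n) : Fin n → ℕ :=
  fun i => v i (bundle X (some i))

/-- The valuations of the agents and of the dummy agent, who values each bundle `S` at `c|S|`. -/
def extVal (c : ℕ) (v : Fin n → Finset G → ℕ) : Option (Fin n) → Finset G → ℕ
  | none => fun S => c * S.card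
  | some i => v i

/-- The functions `β` of the agents and of the dummy agent. -/
def extBeta (c : ℕ) (v : Fin n → Finset G → ℕ) (k : Option (Fin n)) : Finset G → ℕ :=
  beta c (extVal c v k)

/-- Clean allocations. -/
def Clean (c : ℕ) (v : Fin n → Finset G → ℕ) (X : Allocation G n) : Prop :=
  ∀ k : Option (Fin n), extBeta c v k (bundle X k) = (bundle X k).card

/-- The union of a clean allocation and a supplementary allocation.  Whenever it is formed, goods
supplementarily allocated are in the dummy bundle of `Xc`, so that the bundle of each agent is the
union of the two bundles. -/
def union (Xc X1 : Allocation G n) : Allocation G n :=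
  fun g => (Xc g).or (X1 g)

/-- `Xc`, `X1` is a decomposition of `X` into a clean and a supplementary allocation. -/
structure IsDecomposition (c : ℕ) (v : Fin n → Finset G → ℕ) (X Xc X1 : Allocation G n) : Prop where
  clean : Clean c v Xc
  disjoint : ∀ i : Fin n, Disjoint (bundle Xc (some i)) (bundle X1 (some i))
  union_eq : ∀ i : Fin n, bundle Xc (some i) ∪ bundle X1 (some i) = bundle X (some i)
  card_eq : ∀ i : Fin n, (bundle Xc (some i)).card = extBeta c v (some i) (bundle X (some i))

/-- `X` dominates `Y`. -/
def Dominates (c : ℕ) (v : Fin n → Finset G → ℕ) (X Y : Allocation G n) : Prop :=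
  ∃ Xc X1 Yc Y1 : Allocation G n, IsDecomposition c v X Xc X1 ∧ IsDecomposition c v Y Yc Y1 ∧
    (LexDom (sorted (utility v Xc)) (sorted (utility v Yc)) ∨
      (sorted (utility v Xc) = sorted (utility v Yc) ∧ LexDom (utility v Xc) (utility v Yc)) ∨
      (utility v Xc = utility v Yc ∧ LexDom (utility v X) (utility v Y)))

/-- `X` is `Ψ`-maximizing: no allocation is strictly better. -/
def IsMaximizing (Ψ : JusticeCriterion n) (v : Fin n → Finset G → ℕ) (X : Allocation G n) : Prop :=
  ∀ Y : Allocation G n, ¬ Ψ.gt (utility v Y) (utility v X)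

/-- `X` is a dominating `Ψ`-maximizing allocation. -/
def IsDominatingMaximizing (Ψ : JusticeCriterion n) (c : ℕ) (v : Fin n → Finset G → ℕ)
    (X : Allocation G n) : Prop :=
  IsMaximizing Ψ v X ∧ ∀ Y : Allocation G n, IsMaximizing Ψ v Y → ¬ Dominates c v Y X

/-! ### Exchange graph and path augmentation -/

/-- The edges of the exchange graph: `g → g'` if `g ∈ X_j` and `β_j(X_j - g + g') = β_j(X_j)`. -/
def ExchangeEdge (c : ℕ) (v : Fin n → Finset G → ℕ) (X : Allocation G n) (g g' : G) : Prop :=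
  ∃ j : Option (Fin n), g ∈ bundle X j ∧
    extBeta c v j (insert g' ((bundle X j).erase g)) = extBeta c v j (bundle X j)

/-- `F_i(X)`: the goods with marginal gain `1` for `i` under `β_i`. -/
def gainSet (c : ℕ) (v : Fin n → Finset G → ℕ) (X : Allocation G n) (i : Fin n) : Set G :=
  {g | marginal (extBeta c v (some i)) (bundle X (some i)) g = 1}

/-- `P` is a path in the exchange graph from `F_i(X)` to the dummy bundle `X_0`. -/
structure IsTransferPath (c : ℕ) (v : Fin n → Finset G → ℕ) (X : Allocation G n) (i : Fin n)
    (P : List G) : Prop where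
  nodup : P.Nodup
  chain : P.IsChain (ExchangeEdge c v X)
  head_mem : ∃ g ∈ P.head?, g ∈ gainSet c v X i
  last_mem : ∃ g ∈ P.getLast?, g ∈ bundle X none

/-- `P` is a shortest such path (a shortest path need not be unique). -/
def IsShortestTransferPath (c : ℕ) (v : Fin n → Finset G → ℕ) (X : Allocation G n) (i : Fin n)
    (P : List G) : Prop :=
  IsTransferPath c v X i P ∧ ∀ Q : List G, IsTransferPath c v X i Q → P.length ≤ Q.length

/-- Transfer of goods along the path `P = (g₁, …, g_t)`: `g₁` is given to `k`, and each `g_{s+1}` is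
given to the owner of `g_s` under `X`. -/
def transfer (X : Allocation G n) : Option (Fin n) → List G → Allocation G n
  | _, [] => X
  | k, g :: P => Function.update (transfer X (X g) P) g k

end Allocations

/-! ### Bivalued Yankee Swap -/

/-- The variables of the algorithm. -/
structure State (G : Type*) (n : ℕ) where
  /-- the clean allocation `X^c` -/
  Xc : Allocation G n
  /-- the provisional (supplementary) allocation `X^1` -/
  X1 : Allocation G n
  /-- the agents still in play for goods of value `c` -/
  U : Finset (Fin n)

/-- `i` is the least element of `argmax_{k ∈ A} f k`. -/
def IsLeastArgmax {n : ℕ} (A : Finset (Fin n)) (f : Fin n → ℝ) (i : Fin n) : Prop :=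
  i ∈ A ∧ (∀ k ∈ A, f k ≤ f i) ∧ ∀ k ∈ A, f k = f i → i ≤ k

/-- `max_{k ∈ A} f k`, which is `-∞` for empty `A`. -/
noncomputable def maxGain {n : ℕ} (A : Finset (Fin n)) (f : Fin n → ℝ) : WithBot ℝ :=
  A.sup (fun k => (f k : WithBot ℝ))

section Algorithm

variable {G : Type*} [Fintype G] [DecidableEq G] {n : ℕ}

namespace State

/-- The allocation `X^c ∪ X^1`. -/
def alloc (s : State G n) : Allocation G n := union s.Xc s.X1

/-- The initial state. -/
def init : State G n := ⟨fun _ => none, fun _ => none, Finset.univ⟩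

/-- The guard `∑_h |X^1_h| < |X^c_0|` of the while loop. -/
def Guard (s : State G n) : Prop :=
  ∑ h : Fin n, (bundle s.X1 (some h)).card < (bundle s.Xc none).card

/-- The gain of adding `d` to the utility of `k` under the current allocation. -/
def gain (φ : (Fin n → ℕ) → Fin n → ℕ → ℝ) (v : Fin n → Finset G → ℕ) (d : ℕ)
    (s : State G n) (k : Fin n) : ℝ :=
  φ (utility v s.alloc) k d

noncomputable def gainC (c : ℕ) (φ : (Fin n → ℕ) → Fin n → ℕ → ℝ) (v : Fin n → Finset G → ℕ)
    (s : State G n) : WithBot ℝ :=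
  maxGain s.U (s.gain φ v c)

noncomputable def gainOne (φ : (Fin n → ℕ) → Fin n → ℕ → ℝ) (v : Fin n → Finset G → ℕ)
    (s : State G n) : WithBot ℝ :=
  maxGain (Finset.univ \ s.U) (s.gain φ v 1)

end State

/-- The update of `X^1` after `last` has been taken from the dummy bundle and `Xc` has become the
current clean allocation: a stolen provisionally allocated good is replaced by an arbitrary
unallocated one. -/
inductive Repair (Xc : Allocation G n) (last : G) (X1 : Allocation G n) : Allocation G n → Prop
  | keep (h : X1 last = none) : Repair Xc last X1 X1
  | replace (j : Fin n) (h : X1 last = some j) (g : G) (hgc : Xc g = none) (hg1 : X1 g = none) :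
      Repair Xc last X1 (Function.update (Function.update X1 last none) g (some j))

/-- One iteration of the while loop.  Every choice the algorithm leaves open (which shortest path,
which unallocated good) may be made arbitrarily. -/
inductive Step (c : ℕ) (v : Fin n → Finset G → ℕ) (φ : (Fin n → ℕ) → Fin n → ℕ → ℝ) :
    State G n → State G n → Prop
  | augment (s : State G n) (hs : s.Guard) (hgain : s.gainOne φ v ≤ s.gainC c φ v)
      (i : Fin n) (hi : IsLeastArgmax s.U (s.gain φ v c) i)
      (P : List G) (hP : IsShortestTransferPath c v s.Xc i P)
      (last : G) (hlast : last ∈ P.getLast?)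
      (X1' : Allocation G n) (hX1 : Repair (transfer s.Xc (some i) P) last s.X1 X1') :
      Step c v φ s ⟨transfer s.Xc (some i) P, X1', s.U⟩
  | remove (s : State G n) (hs : s.Guard) (hgain : s.gainOne φ v ≤ s.gainC c φ v)
      (i : Fin n) (hi : IsLeastArgmax s.U (s.gain φ v c) i)
      (hP : ¬ ∃ P : List G, IsTransferPath c v s.Xc i P) :
      Step c v φ s ⟨s.Xc, s.X1, s.U.erase i⟩
  | provisional (s : State G n) (hs : s.Guard) (hgain : s.gainC c φ v < s.gainOne φ v)
      (i : Fin n) (hi : IsLeastArgmax (Finset.univ \ s.U) (s.gain φ v 1) i)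
      (g : G) (hgc : s.Xc g = none) (hg1 : s.X1 g = none) :
      Step c v φ s ⟨s.Xc, Function.update s.X1 g (some i), s.U⟩

/-- `s` occurs in some run of the algorithm. -/
def Reachable (c : ℕ) (v : Fin n → Finset G → ℕ) (φ : (Fin n → ℕ) → Fin n → ℕ → ℝ)
    (s : State G n) : Prop :=
  Relation.ReflTransGen (Step c v φ) State.init s

/-- Every run of the algorithm ends after finitely many iterations, by leaving the while loop (it
never gets stuck inside the loop), and the returned allocation satisfies `Q`. -/
def AlwaysOutputs (c : ℕ) (v : Fin n → Finset G → ℕ) (φ : (Fin n → ℕ) → Fin n → ℕ → ℝ)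
    (Q : Allocation G n → Prop) : Prop :=
  (¬ ∃ run : ℕ → State G n, run 0 = State.init ∧ ∀ t, Step c v φ (run t) (run (t + 1))) ∧
  (∀ s, Reachable c v φ s → s.Guard → ∃ s', Step c v φ s s') ∧
  (∀ s, Reachable c v φ s → ¬ s.Guard → Q s.alloc)

end Algorithm

end BYS

/-!
A bivalued submodular valuation is `v S = |S| + (c - 1) r(S)`, where `r = β` is a matroid rank
function (`IsBivaluedSubmodular.beta_spec`).  So an allocation matters only through the vector `d`
of the numbers of goods received at value `c`, which ranges over the set `cleanSizes` of size
vectors of clean allocations, and the vector `e` of the numbers of goods received at value `1`; the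
utilities are `c * d + e`.  Up to Pareto improvements, a pair `(d, e)` is constrained only by
`d ∈ cleanSizes` and by the number of goods.

Matroid theory enters through two facts.  Transferring goods along a shortest path keeps an
allocation clean (`IsShortestTransferPath.clean_transfer`), and if no path leaves any agent of a
set `J`, then a superset of `J` is tight, i.e. holds as many goods as in any clean allocation
(`exists_tight_of_no_path`).  Hence a path for `i` exists if and only if `d + e_i ∈ cleanSizes`
(`exists_path_iff`), an agent without a path never gets one later, and `cleanSizes` has a
polymatroid exchange property (`exists_exchange`).

Fix a best pair (`IsBest`): one with a `Ψ`-maximal utility vector and, among these, one that is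
not dominated.  The current pair `(d, e)` of the algorithm stays coordinatewise below it.  If the
algorithm gives a good to `i` but the best pair has no further good of this kind for `i`, then the
best pair has some other unit that the current pair lacks; moving this unit to `i`, after an
exchange in `cleanSizes` if necessary, is a `Ψ`-improvement, or a `Ψ`-tie that improves the
domination order, because `i` maximizes the gain and gains decrease with utility
(`IsBest.add_single_le_left`, `IsBest.add_single_le_right`).  When the loop ends all goods are
allocated, so the pair of the algorithm equals the best pair.  Termination is clear, as every
iteration allocates one more good or removes an agent from `U`.
-/

namespace BYS

/-! ### Rank functions of bivalued submodular valuations -/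

section Rank

variable {G : Type*} [DecidableEq G]

/-- Rank functions of matroids: monotone submodular set functions with marginals at most `1`.
A set `S` is independent if `r S = S.card`, and spans `g` if `r (insert g S) = r S`. -/
structure IsRankFunction (r : Finset G → ℕ) : Prop where
  empty : r ∅ = 0
  mono : ∀ {S T : Finset G}, S ⊆ T → r S ≤ r T
  insert_le : ∀ (S : Finset G) (g : G), r (insert g S) ≤ r S + 1
  submod : ∀ A B : Finset G, r (A ∪ B) + r (A ∩ B) ≤ r A + r B

namespace IsRankFunction

variable {r : Finset G → ℕ}

theorem le_card (hr : IsRankFunction r) (S : Finset G) : r S ≤ S.card := by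
  induction S using Finset.induction_on with
  | empty => simp [hr.empty]
  | insert g S hg ih =>
    have := hr.insert_le S g
    rw [Finset.card_insert_of_notMem hg]
    omega

theorem exists_indep_subset (hr : IsRankFunction r) (S : Finset G) :
    ∃ T ⊆ S, r T = T.card ∧ T.card = r S := by
  induction S using Finset.induction_on with
  | empty => exact ⟨∅, by simp, by simp [hr.empty], by simp [hr.empty]⟩
  | insert g S hg ih =>
    obtain ⟨T, hTS, hT, hTc⟩ := ih
    have h1 := hr.insert_le S g
    have h2 := hr.mono (Finset.subset_insert g S)
    by_cases h : r (insert g S) = r S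
    · exact ⟨T, hTS.trans (Finset.subset_insert _ _), hT, by omega⟩
    · have hgT : g ∉ T := fun h => hg (hTS h)
      have h3 := hr.submod (insert g T) S
      have h4 : insert g T ∪ S = insert g S := by
        rw [Finset.insert_union, Finset.union_eq_right.2 hTS]
      have h5 : insert g T ∩ S = T := by
        rw [Finset.insert_inter_of_notMem hg, Finset.inter_eq_left.2 hTS]
      have h6 := hr.le_card (insert g T)
      rw [h4, h5] at h3
      refine ⟨insert g T, Finset.insert_subset_insert _ hTS, ?_, ?_⟩ <;>
        rw [Finset.card_insert_of_notMem hgT] at * <;> omega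

theorem indep_subset (hr : IsRankFunction r) {S T : Finset G} (hTS : T ⊆ S)
    (hS : r S = S.card) : r T = T.card := by
  have h1 := hr.submod T (S \ T)
  rw [Finset.union_sdiff_of_subset hTS, Finset.inter_sdiff_self, hr.empty] at h1
  have h2 := hr.le_card (S \ T)
  have h3 := hr.le_card T
  have h4 := Finset.card_sdiff_add_card_eq_card hTS
  omega

theorem span_mono (hr : IsRankFunction r) {S T : Finset G} (hST : S ⊆ T) {g : G}
    (h : r (insert g S) = r S) : r (insert g T) = r T := by
  by_cases hg : g ∈ T
  · rw [Finset.insert_eq_of_mem hg]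
  have h1 := hr.submod (insert g S) T
  rw [Finset.insert_union, Finset.union_eq_right.2 hST, Finset.insert_inter_of_notMem hg,
    Finset.inter_eq_left.2 hST] at h1
  have := hr.mono (Finset.subset_insert g T)
  omega

theorem rank_union_of_span (hr : IsRankFunction r) (S T : Finset G)
    (h : ∀ g ∈ T, r (insert g S) = r S) : r (S ∪ T) = r S := by
  induction T using Finset.induction_on with
  | empty => simp
  | insert g T hg ih =>
    rw [Finset.union_insert, hr.span_mono Finset.subset_union_left
      (h g (Finset.mem_insert_self _ _))]
    exact ih fun x hx => h x (Finset.mem_insert_of_mem hx)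

/-- If `S` spans `T` but not `y`, then `T` does not span `y`. -/
theorem not_span_of_span (hr : IsRankFunction r) {S T : Finset G} {y : G}
    (h : ∀ g ∈ T, r (insert g S) = r S) (hy : r (insert y S) ≠ r S) :
    r (insert y T) ≠ r T := by
  intro h1
  have h2 := hr.span_mono (Finset.subset_union_right (s₁ := S)) h1
  rw [hr.rank_union_of_span S T h] at h2
  have h3 := hr.mono (Finset.insert_subset_insert y (Finset.subset_union_left (s₁ := S) (s₂ := T)))
  have h4 := hr.mono (Finset.subset_insert y S)
  omega

theorem indep_insert (hr : IsRankFunction r) {T : Finset G} {y : G} (hT : r T = T.card)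
    (hy : r (insert y T) ≠ r T) : r (insert y T) = (insert y T).card := by
  have h1 := hr.insert_le T y
  have h2 := hr.mono (Finset.subset_insert y T)
  have h3 : y ∉ T := fun h => hy (by rw [Finset.insert_eq_of_mem h])
  rw [Finset.card_insert_of_notMem h3]
  omega

/-- For independent `X`, deleting one element keeps `y` spanned unless exchanging it for `y`
preserves the rank. -/
theorem span_erase (hr : IsRankFunction r) {X : Finset G} (hX : r X = X.card) {x y : G}
    (hx : x ∈ X) (hy : r (insert y (X.erase x)) ≠ r X) :
    r (insert y (X.erase x)) = r (X.erase x) := by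
  have h1 := hr.insert_le (X.erase x) y
  have h2 := hr.mono (Finset.subset_insert y (X.erase x))
  have h3 := hr.indep_subset (Finset.erase_subset x X) hX
  have h4 := Finset.card_erase_add_one hx
  omega

/-- The elements of an independent set `X` that cannot be exchanged for `y` are not needed to span
`y`. -/
theorem span_sdiff (hr : IsRankFunction r) {X : Finset G} (hX : r X = X.card) {y : G}
    (hy : r (insert y X) = r X) (S : Finset G)
    (hS : ∀ x ∈ S, x ∈ X → r (insert y (X.erase x)) ≠ r X) :
    r (insert y (X \ S)) = r (X \ S) := by
  induction S using Finset.induction_on with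
  | empty => simpa using hy
  | insert x S hxS ih =>
    have ih := ih fun z hz => hS z (Finset.mem_insert_of_mem hz)
    by_cases hx : x ∈ X
    swap
    · rwa [Finset.sdiff_insert_of_notMem hx]
    have hsp := hr.span_erase hX hx (hS x (Finset.mem_insert_self _ _) hx)
    by_cases hyX : y ∈ X.erase x
    · by_cases hyS : y ∈ S
      · have := hS y (Finset.mem_insert_of_mem hyS) (Finset.mem_of_mem_erase hyX)
        rw [Finset.insert_erase (Finset.mem_of_mem_erase hyX)] at this
        exact absurd rfl this
      · rw [Finset.insert_eq_of_mem]
        simp only [Finset.mem_erase] at hyX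
        simp [hyX, hyS]
    have hyx : y ≠ x := by
      rintro rfl
      have := hS y (Finset.mem_insert_self _ _) hx
      rw [Finset.insert_erase hx] at this
      exact this rfl
    have hyX' : y ∉ X := fun h => hyX (Finset.mem_erase.2 ⟨hyx, h⟩)
    have h1 := hr.submod (insert y (X \ S)) (insert y (X.erase x))
    have h2 : insert y (X \ S) ∪ insert y (X.erase x) = insert y X := by
      ext z
      simp only [Finset.mem_union, Finset.mem_insert, Finset.mem_sdiff, Finset.mem_erase]
      by_cases hzx : z = x
      · subst hzx; tauto
      · tauto
    have h3 : insert y (X \ S) ∩ insert y (X.erase x) = insert y (X \ insert x S) := by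
      ext z
      simp only [Finset.mem_inter, Finset.mem_insert, Finset.mem_sdiff, Finset.mem_erase]
      tauto
    rw [h2, h3, ih, hsp, hy] at h1
    have h4 := hr.mono (Finset.subset_insert y (X \ insert x S))
    have h5 := hr.indep_subset (Finset.sdiff_subset (s := X) (t := insert x S)) hX
    have h6 := hr.indep_subset (Finset.sdiff_subset (s := X) (t := S)) hX
    have h7 := hr.indep_subset (Finset.erase_subset x X) hX
    have h8 := Finset.card_erase_add_one hx
    have h9 : (X \ insert x S) = (X \ S).erase x := by
      ext z
      simp only [Finset.mem_insert, Finset.mem_sdiff, Finset.mem_erase]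
      tauto
    have h10 := Finset.card_erase_add_one (s := X \ S) (a := x) (by simp [hx, hxS])
    rw [← h9] at h10
    omega

end IsRankFunction

/-- A bivalued submodular valuation is a combination of the cardinality and of a matroid rank
function. -/
theorem IsBivaluedSubmodular.exists_rank {c : ℕ} (hc : 2 ≤ c) {v : Finset G → ℕ}
    (hv : IsBivaluedSubmodular 1 c v) :
    ∃ r : Finset G → ℕ, IsRankFunction r ∧ ∀ S, v S = S.card + (c - 1) * r S := by
  have hex : ∀ S : Finset G, ∃ k, v S = S.card + (c - 1) * k := by
    intro S
    induction S using Finset.induction_on with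
    | empty => exact ⟨0, by simp [hv.empty]⟩
    | insert g S hg ih =>
      obtain ⟨k, hk⟩ := ih
      rw [Finset.card_insert_of_notMem hg]
      rcases hv.marginal_mem S g hg with h | h <;> unfold marginal at h
      · exact ⟨k, by push_cast at h; omega⟩
      · refine ⟨k + 1, ?_⟩
        rw [mul_add]
        omega
  choose r hr using hex
  have hmarg : ∀ S g, g ∉ S → marginal v S g = 1 + (c - 1 : ℤ) * ((r (insert g S) : ℤ) - r S) := by
    intro S g hg
    unfold marginal
    rw [hr S, hr (insert g S), Finset.card_insert_of_notMem hg]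
    push_cast [Nat.cast_sub (show 1 ≤ c by omega)]
    ring
  have hc' : (0 : ℤ) < (c : ℤ) - 1 := by omega
  have hstep : ∀ S g, g ∉ S → r (insert g S) = r S ∨ r (insert g S) = r S + 1 := by
    intro S g hg
    rcases hv.marginal_mem S g hg with h | h <;> rw [hmarg S g hg] at h
    · left
      have : (c - 1 : ℤ) * ((r (insert g S) : ℤ) - r S) = 0 := by push_cast at h; linarith
      rcases mul_eq_zero.1 this with h | h <;> omega
    · right
      have : (c - 1 : ℤ) * ((r (insert g S) : ℤ) - r S - 1) = 0 := by linarith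
      rcases mul_eq_zero.1 this with h | h <;> omega
  have hle : ∀ S g, r S ≤ r (insert g S) := by
    intro S g
    by_cases hg : g ∈ S
    · rw [Finset.insert_eq_of_mem hg]
    · rcases hstep S g hg with h | h <;> omega
  have hmono : ∀ S T : Finset G, r S ≤ r (S ∪ T) := by
    intro S T
    induction T using Finset.induction_on with
    | empty => simp
    | insert g T _ ih => rw [Finset.union_insert]; exact ih.trans (hle _ _)
  have hsub : ∀ S T : Finset G, S ⊆ T → ∀ C : Finset G,
      r (T ∪ C) + r S ≤ r (S ∪ C) + r T := by
    intro S T hST C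
    induction C using Finset.induction_on with
    | empty => simp; omega
    | insert g C _ ih =>
      rw [Finset.union_insert, Finset.union_insert]
      by_cases hg : g ∈ T ∪ C
      · rw [Finset.insert_eq_of_mem hg]
        have := hle (S ∪ C) g
        omega
      · have hsub := Finset.union_subset_union_left (t := C) hST
        have h := hv.submodular _ _ g hsub hg
        rw [hmarg _ _ hg, hmarg _ _ (fun h => hg (hsub h))] at h
        have h' := le_of_mul_le_mul_left ((Int.add_le_add_iff_left (a := (1 : ℤ))).1 h) hc'
        omega
  refine ⟨r, ⟨?_, ?_, ?_, ?_⟩, hr⟩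
  · have h := hr ∅
    rw [hv.empty] at h
    rcases Nat.mul_eq_zero.1 (by simpa using h.symm : (c - 1) * r ∅ = 0) with h | h
    · omega
    · exact h
  · intro S T hST
    have := hmono S T
    rwa [Finset.union_eq_right.2 hST] at this
  · intro S g
    by_cases hg : g ∈ S
    · rw [Finset.insert_eq_of_mem hg]; omega
    · rcases hstep S g hg with h | h <;> omega
  · intro A B
    have := hsub (A ∩ B) A Finset.inter_subset_left B
    rw [Finset.union_eq_right.2 (Finset.inter_subset_right (s₁ := A) (s₂ := B))] at this
    omega

/-- The rank function belonging to a bivalued submodular valuation is `β`. -/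
theorem IsBivaluedSubmodular.beta_spec {c : ℕ} (hc : 2 ≤ c) {v : Finset G → ℕ}
    (hv : IsBivaluedSubmodular 1 c v) :
    IsRankFunction (beta c v) ∧ ∀ S, v S = S.card + (c - 1) * beta c v S := by
  obtain ⟨r, hr, hvr⟩ := hv.exists_rank hc
  have hiff : ∀ T, v T = c * T.card ↔ r T = T.card := by
    intro T
    have h1 : c * T.card = T.card + (c - 1) * T.card := by
      obtain ⟨k, rfl⟩ : ∃ k, c = k + 1 := ⟨c - 1, by omega⟩
      simp only [Nat.add_sub_cancel]
      ring
    rw [hvr, h1, Nat.add_left_cancel_iff, Nat.mul_right_inj (by omega)]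
  have hβ : beta c v = r := by
    funext S
    unfold beta
    refine le_antisymm (Finset.sup_le ?_) ?_
    · intro T hT
      rw [Finset.mem_filter, Finset.mem_powerset, hiff] at hT
      rw [← hT.2]
      exact hr.mono hT.1
    · obtain ⟨T, hTS, hT, hTc⟩ := hr.exists_indep_subset S
      rw [← hTc]
      exact Finset.le_sup (f := Finset.card)
        (Finset.mem_filter.2 ⟨Finset.mem_powerset.2 hTS, (hiff T).2 hT⟩)
  rw [hβ]
  exact ⟨hr, hvr⟩

variable {n : ℕ} {c : ℕ} {v : Fin n → Finset G → ℕ}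

theorem isBivaluedSubmodular_extVal (hv : ∀ i, IsBivaluedSubmodular 1 c (v i))
    (k : Option (Fin n)) : IsBivaluedSubmodular 1 c (extVal c v k) := by
  cases k with
  | some i => exact hv i
  | none =>
    have h : ∀ (S : Finset G) (g : G), g ∉ S →
        marginal (extVal c v none) S g = (c : ℤ) := by
      intro S g hg
      simp only [marginal, extVal]
      rw [Finset.card_insert_of_notMem hg]
      push_cast
      ring
    refine ⟨by simp [extVal], fun S g hg => Or.inr (h S g hg), fun S T g hST hg => ?_⟩
    rw [h S g fun h => hg (hST h), h T g hg]

theorem isRankFunction_extBeta (hc : 2 ≤ c) (hv : ∀ i, IsBivaluedSubmodular 1 c (v i))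
    (k : Option (Fin n)) : IsRankFunction (extBeta c v k) :=
  ((isBivaluedSubmodular_extVal hv k).beta_spec hc).1

theorem val_eq (hc : 2 ≤ c) (hv : ∀ i, IsBivaluedSubmodular 1 c (v i)) (i : Fin n)
    (S : Finset G) : v i S = S.card + (c - 1) * extBeta c v (some i) S :=
  ((isBivaluedSubmodular_extVal hv (some i)).beta_spec hc).2 S

theorem extBeta_none (hc : 2 ≤ c) (hv : ∀ i, IsBivaluedSubmodular 1 c (v i)) (S : Finset G) :
    extBeta c v none S = S.card := by
  have h := ((isBivaluedSubmodular_extVal hv none).beta_spec hc).2 S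
  obtain ⟨k, rfl⟩ : ∃ k, c = k + 1 := ⟨c - 1, by omega⟩
  simp only [extVal, Nat.add_sub_cancel] at h
  have h' : k * S.card = k * extBeta (k + 1) v none S := by
    have : (k + 1) * S.card = S.card + k * S.card := by ring
    change (k + 1) * S.card = S.card + k * extBeta (k + 1) v none S at h
    omega
  exact (Nat.eq_of_mul_eq_mul_left (by omega) h').symm

end Rank

/-! ### Size vectors of clean allocations -/

section Sizes

variable {G : Type*} [Fintype G] [DecidableEq G] {n : ℕ} {c : ℕ} {v : Fin n → Finset G → ℕ}

/-- The vector of the bundle sizes of the agents. -/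
def sizes (X : Allocation G n) : Fin n → ℕ := fun i => (bundle X (some i)).card

/-- The size vectors of clean allocations, i.e. the vectors of the numbers of goods that the agents
can simultaneously receive at value `c`.  These are the integer points of a polymatroid. -/
def cleanSizes (c : ℕ) (v : Fin n → Finset G → ℕ) : Set (Fin n → ℕ) :=
  {d | ∃ X : Allocation G n, Clean c v X ∧ sizes X = d}

omit [DecidableEq G] in
@[simp] theorem mem_bundle {X : Allocation G n} {k : Option (Fin n)} {g : G} :
    g ∈ bundle X k ↔ X g = k := by simp [bundle]

omit [DecidableEq G] in
theorem sum_card_bundle (X : Allocation G n) :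
    ∑ i, sizes X i + (bundle X none).card = Fintype.card G := by
  have h := Finset.card_eq_sum_card_fiberwise (f := X) (s := Finset.univ) (t := Finset.univ)
    (by simp)
  rw [Fintype.sum_option] at h
  rw [← Finset.card_univ, h, add_comm]
  rfl

/-- Any allocation contains a clean allocation with prescribed independent bundles. -/
theorem exists_clean_of_subset (hc : 2 ≤ c) (hv : ∀ i, IsBivaluedSubmodular 1 c (v i))
    (X : Allocation G n) (T : Fin n → Finset G) (hT : ∀ i, T i ⊆ bundle X (some i))
    (hTi : ∀ i, extBeta c v (some i) (T i) = (T i).card) :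
    ∃ Y : Allocation G n, Clean c v Y ∧ ∀ i, bundle Y (some i) = T i := by
  have hX : ∀ i, ∀ g ∈ T i, X g = some i := fun i g hg => mem_bundle.1 (hT i hg)
  let Y : Allocation G n := fun g => (X g).bind fun i => if g ∈ T i then some i else none
  have hb : ∀ i, bundle Y (some i) = T i := by
    intro i
    ext g
    rw [mem_bundle]
    constructor
    · intro h
      simp only [Y, Option.bind_eq_some_iff] at h
      obtain ⟨j, -, h⟩ := h
      split_ifs at h with hj
      rw [← Option.some.inj h]
      exact hj
    · intro h
      simp [Y, hX i g h, h]
  refine ⟨Y, fun k => ?_, hb⟩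
  cases k with
  | none => exact extBeta_none hc hv _
  | some i => rw [hb, hTi]

theorem cleanSizes_mono (hc : 2 ≤ c) (hv : ∀ i, IsBivaluedSubmodular 1 c (v i))
    {d d' : Fin n → ℕ} (hd : d ∈ cleanSizes c v) (hle : d' ≤ d) : d' ∈ cleanSizes c v := by
  obtain ⟨X, hX, rfl⟩ := hd
  choose T hT hTc using fun i => Finset.exists_subset_card_eq (hle i)
  obtain ⟨Y, hY, hYT⟩ := exists_clean_of_subset hc hv X T hT
    fun i => (isRankFunction_extBeta hc hv _).indep_subset (hT i) (hX _)
  exact ⟨Y, hY, funext fun i => by rw [sizes, hYT, hTc]⟩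

theorem zero_mem_cleanSizes (hc : 2 ≤ c) (hv : ∀ i, IsBivaluedSubmodular 1 c (v i)) :
    (0 : Fin n → ℕ) ∈ cleanSizes c v := by
  obtain ⟨Y, hY, hYT⟩ := exists_clean_of_subset hc hv (fun _ => none) (fun _ => ∅)
    (fun _ => Finset.empty_subset _)
    fun i => by simp [(isRankFunction_extBeta hc hv _).empty]
  exact ⟨Y, hY, funext fun i => by simp [sizes, hYT]⟩

theorem extBeta_mem_cleanSizes (hc : 2 ≤ c) (hv : ∀ i, IsBivaluedSubmodular 1 c (v i))
    (X : Allocation G n) :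
    (fun i => extBeta c v (some i) (bundle X (some i))) ∈ cleanSizes c v := by
  choose T hT hTi hTc using fun i : Fin n =>
    (isRankFunction_extBeta hc hv (some i)).exists_indep_subset (bundle X (some i))
  obtain ⟨Y, hY, hYT⟩ := exists_clean_of_subset hc hv X T hT hTi
  exact ⟨Y, hY, funext fun i => by rw [sizes, hYT, hTc]⟩

/-! ### Saturated agents and tight sets -/

/-- The goods that can be reached in the exchange graph from `F_i(X)` by a path. -/
def reachableFrom (c : ℕ) (v : Fin n → Finset G → ℕ) (X : Allocation G n) (i : Fin n) : Set G :=
  {g | ∃ P : List G, P.Nodup ∧ P.IsChain (ExchangeEdge c v X) ∧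
    (∃ a ∈ P.head?, a ∈ gainSet c v X i) ∧ g ∈ P.getLast?}

theorem gainSet_subset_reachableFrom (X : Allocation G n) (i : Fin n) :
    gainSet c v X i ⊆ reachableFrom c v X i :=
  fun g hg => ⟨[g], by simp, by simp, ⟨g, by simp, hg⟩, by simp⟩

theorem reachableFrom_closed {X : Allocation G n} {i : Fin n} {g g' : G}
    (hg : g ∈ reachableFrom c v X i) (he : ExchangeEdge c v X g g') :
    g' ∈ reachableFrom c v X i := by
  obtain ⟨P, hnd, hch, ⟨a, ha, hai⟩, hl⟩ := hg
  by_cases hmem : g' ∈ P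
  · -- a prefix of the given path already leads to `g'`
    obtain ⟨A, B, rfl⟩ := List.append_of_mem hmem
    have hpre : A ++ [g'] <+: A ++ g' :: B := ⟨B, by simp⟩
    refine ⟨A ++ [g'], hnd.sublist hpre.sublist, hch.prefix hpre, ⟨a, ?_, hai⟩, by simp⟩
    cases A <;> simpa using ha
  · refine ⟨P ++ [g'], ?_, ?_, ⟨a, ?_, hai⟩, by simp⟩
    · rw [List.nodup_append]
      refine ⟨hnd, by simp, ?_⟩
      intro x hx y hy
      rw [List.mem_singleton] at hy
      rintro rfl
      exact hmem (hy ▸ hx)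
    · rw [List.isChain_append]
      refine ⟨hch, by simp, ?_⟩
      intro x hx y hy
      have hxg : x = g := Option.mem_unique hx hl
      have : y = g' := by simpa using hy.symm
      rw [hxg, this]
      exact he
    · cases P with
      | nil => simp at ha
      | cons => simpa using ha

/-- If no transfer path starts at any agent of `J`, then some set `K ⊇ J` of agents holds as many
goods as in any clean allocation: the agents of `K` are those of `J` and the owners of the goods
`R` reachable from `J`, and outside `R` their bundles span all goods. -/
theorem exists_tight_of_no_path (hc : 2 ≤ c) (hv : ∀ i, IsBivaluedSubmodular 1 c (v i))
    {X : Allocation G n} (hX : Clean c v X) (J : Finset (Fin n))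
    (hJ : ∀ i ∈ J, ¬ ∃ P, IsTransferPath c v X i P) :
    ∃ K : Finset (Fin n), J ⊆ K ∧ ∀ Z : Allocation G n, Clean c v Z →
      ∑ i ∈ K, sizes Z i ≤ ∑ i ∈ K, sizes X i := by
  classical
  let R : Finset G := Finset.univ.filter fun g => ∃ i ∈ J, g ∈ reachableFrom c v X i
  let K : Finset (Fin n) := Finset.univ.filter fun k => k ∈ J ∨ ∃ g ∈ R, X g = some k
  have hR : ∀ g, g ∈ R ↔ ∃ i ∈ J, g ∈ reachableFrom c v X i := by simp [R]
  have hRnone : ∀ g ∈ R, X g ≠ none := by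
    intro g hg h0
    obtain ⟨i, hi, P, h1, h2, h3, h4⟩ := (hR g).1 hg
    exact hJ i hi ⟨P, h1, h2, h3, g, h4, by simpa using h0⟩
  have hspan : ∀ k ∈ K, ∀ g, g ∉ R →
      extBeta c v (some k) (insert g (bundle X (some k) \ R)) =
        extBeta c v (some k) (bundle X (some k) \ R) := by
    intro k hk g hg
    have hr := isRankFunction_extBeta hc hv (some k)
    have hne : ∀ x ∈ R, x ∈ bundle X (some k) →
        extBeta c v (some k) (insert g ((bundle X (some k)).erase x)) ≠
          extBeta c v (some k) (bundle X (some k)) := by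
      intro x hx hxk he
      obtain ⟨i, hi, hxi⟩ := (hR x).1 hx
      exact hg ((hR g).2 ⟨i, hi, reachableFrom_closed hxi ⟨some k, hxk, he⟩⟩)
    refine hr.span_sdiff (hX _) ?_ R hne
    rcases (Finset.mem_filter.1 hk).2 with hk | ⟨x, hx, hxk⟩
    · by_contra h
      refine hg ((hR g).2 ⟨k, hk, gainSet_subset_reachableFrom X k ?_⟩)
      have h1 := hr.insert_le (bundle X (some k)) g
      have h2 := hr.mono (Finset.subset_insert g (bundle X (some k)))
      simp only [gainSet, marginal, Set.mem_ofPred_eq]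
      omega
    · exact hr.span_mono (Finset.erase_subset x _)
        (hr.span_erase (hX _) (mem_bundle.2 hxk) (hne x hx (mem_bundle.2 hxk)))
  refine ⟨K, fun i hi => by simp [K, hi], fun Z hZ => ?_⟩
  have hsplit : ∀ (W : Allocation G n) (i : Fin n),
      sizes W i = (bundle W (some i) ∩ R).card + (bundle W (some i) \ R).card :=
    fun W i => (Finset.card_inter_add_card_sdiff _ _).symm
  have hdisj : ∀ W : Allocation G n, (K : Set (Fin n)).PairwiseDisjoint
      fun i => bundle W (some i) ∩ R := by
    intro W i _ j _ hij
    refine Finset.disjoint_left.2 fun g hgi hgj => hij ?_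
    simp only [Finset.mem_inter, mem_bundle] at hgi hgj
    exact Option.some.inj (hgi.1.symm.trans hgj.1)
  simp only [hsplit, Finset.sum_add_distrib]
  refine add_le_add ?_ (Finset.sum_le_sum fun k hk => ?_)
  · rw [← Finset.card_biUnion (hdisj Z), ← Finset.card_biUnion (hdisj X)]
    refine Finset.card_le_card fun g hg => ?_
    obtain ⟨_, _, hg'⟩ := Finset.mem_biUnion.1 hg
    have hgR := (Finset.mem_inter.1 hg').2
    obtain ⟨k, hk⟩ := Option.ne_none_iff_exists'.1 (hRnone g hgR)
    exact Finset.mem_biUnion.2 ⟨k, by simp only [K, Finset.mem_filter]; exact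
      ⟨Finset.mem_univ _, Or.inr ⟨g, hgR, hk⟩⟩, by simp [hk, hgR]⟩
  · have hr := isRankFunction_extBeta hc hv (some k)
    have h1 := hr.rank_union_of_span (bundle X (some k) \ R) (bundle Z (some k) \ R)
      fun g hg => hspan k hk g (Finset.mem_sdiff.1 hg).2
    have h2 := hr.mono (Finset.subset_union_right
      (s₁ := bundle X (some k) \ R) (s₂ := bundle Z (some k) \ R))
    have h3 := hr.indep_subset (Finset.sdiff_subset (t := R)) (hX (some k))
    have h4 := hr.indep_subset (Finset.sdiff_subset (t := R)) (hZ (some k))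
    omega

/-! ### Augmentation along shortest paths -/

omit [Fintype G] in
theorem transfer_of_notMem (X : Allocation G n) (k : Option (Fin n)) (P : List G) {g : G}
    (hg : g ∉ P) : transfer X k P g = X g := by
  induction P generalizing k with
  | nil => rfl
  | cons a P ih =>
    rw [List.mem_cons, not_or] at hg
    rw [transfer, Function.update_of_ne hg.1]
    exact ih _ hg.2

omit [Fintype G] in
theorem eq_or_mem_of_transfer_eq (X : Allocation G n) (a : Option (Fin n)) (P : List G)
    {g : G} {k : Option (Fin n)} (h : transfer X a P g = k) : X g = k ∨ g ∈ P := by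
  by_cases hg : g ∈ P
  · exact Or.inr hg
  · exact Or.inl (transfer_of_notMem X a P hg ▸ h)

/-- Only the last good of a path leaves its bundle without replacement, and only the first one is
received without compensation. -/
theorem card_bundle_transfer (X : Allocation G n) (k a : Option (Fin n)) (P : List G)
    (hP : P.Nodup) (last : G) (hl : last ∈ P.getLast?) :
    (bundle (transfer X a P) k).card + (if X last = k then 1 else 0) =
      (bundle X k).card + if a = k then 1 else 0 := by
  have hupd : ∀ (Y : Allocation G n) (g : G) (b : Option (Fin n)),
      (bundle (Function.update Y g b) k).card + (if Y g = k then 1 else 0) =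
        (bundle Y k).card + if b = k then 1 else 0 := by
    intro Y g b
    have h1 : ∀ (W : Allocation G n), (bundle W k).card =
        ((bundle W k).erase g).card + if W g = k then 1 else 0 := by
      intro W
      split_ifs with h
      · rw [Finset.card_erase_add_one (mem_bundle.2 h)]
      · rw [Finset.erase_eq_of_notMem (by simpa using h), add_zero]
    have h2 : (bundle (Function.update Y g b) k).erase g = (bundle Y k).erase g := by
      ext x
      simp only [Finset.mem_erase, mem_bundle]
      refine and_congr_right fun hx => ?_
      rw [Function.update_of_ne hx]
    rw [h1 (Function.update Y g b), h1 Y, h2, Function.update_self]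
    omega
  induction P generalizing a with
  | nil => simp at hl
  | cons g P ih =>
    rw [List.nodup_cons] at hP
    have h := hupd (transfer X (X g) P) g a
    rw [transfer_of_notMem X _ P hP.1] at h
    rw [transfer]
    cases P with
    | nil =>
      have : last = g := by simpa using hl.symm
      rw [this]
      exact h
    | cons b P =>
      have := ih (X g) hP.2 (by simpa using hl)
      omega

/-- The bundle of `k` stays independent along a path `x :: P` without shortcuts; the good `x` is
left out, as its new owner depends on its predecessor.  Each good `h` that `k` receives in exchange
for `x` is not spanned by the goods of `k` other than `x` and those received further down the path,
all of which are spanned by the goods of `k` other than `x`. -/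
theorem indep_transfer_erase (hc : 2 ≤ c) (hv : ∀ i, IsBivaluedSubmodular 1 c (v i))
    {X : Allocation G n} (hX : Clean c v X) (k : Option (Fin n)) (x : G) (P : List G)
    (hnd : (x :: P).Nodup) (hch : (x :: P).IsChain (ExchangeEdge c v X))
    (hns : ∀ A y h B, x :: P = A ++ y :: h :: B → ∀ z ∈ B, ¬ ExchangeEdge c v X y z) :
    extBeta c v k ((bundle (transfer X (X x) P) k).erase x) =
      ((bundle (transfer X (X x) P) k).erase x).card := by
  have hr := isRankFunction_extBeta hc hv k
  induction P generalizing x with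
  | nil => exact hr.indep_subset (Finset.erase_subset x _) (hX k)
  | cons h P ih =>
    have ih := ih h hnd.of_cons (List.IsChain.tail hch)
      fun A y h' B e => hns (x :: A) y h' B (by rw [e]; rfl)
    have hxh : x ≠ h := by rintro rfl; simp at hnd
    have hxP : x ∉ P := fun hx => by simp [hx] at hnd
    have hedge : ExchangeEdge c v X x h := (List.isChain_cons_cons.1 hch).1
    have hsub : ((bundle (transfer X (X x) (h :: P)) k).erase x).erase h ⊆
        (bundle (transfer X (X h) P) k).erase h := by
      intro z hz
      simp only [Finset.mem_erase, mem_bundle, transfer] at hz ⊢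
      rw [Function.update_of_ne hz.1] at hz
      exact ⟨hz.1, hz.2.2⟩
    have hind := hr.indep_subset hsub ih
    by_cases hxk : X x = k
    · have hmem : h ∈ (bundle (transfer X (X x) (h :: P)) k).erase x := by
        simp [transfer, hxh.symm, hxk]
      rw [← Finset.insert_erase hmem]
      refine hr.indep_insert hind (hr.not_span_of_span (S := (bundle X k).erase x) ?_ ?_)
      · intro z hz
        have hzx : z ≠ x := by
          rintro rfl
          simp at hz
        have hz' := hsub hz
        simp only [Finset.mem_erase, mem_bundle] at hz'
        rcases eq_or_mem_of_transfer_eq X _ P hz'.2 with hz2 | hz2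
        · rw [Finset.insert_eq_of_mem (Finset.mem_erase.2 ⟨hzx, mem_bundle.2 hz2⟩)]
        · refine hr.span_erase (hX k) (mem_bundle.2 hxk) fun he => ?_
          exact hns [] x h P rfl z hz2 ⟨k, mem_bundle.2 hxk, he⟩
      · obtain ⟨j, hj, he⟩ := hedge
        have hjk : j = k := (mem_bundle.1 hj).symm.trans hxk
        subst hjk
        rw [he, hX, hr.indep_subset (Finset.erase_subset x _) (hX j)]
        have := Finset.card_erase_add_one hj
        omega
    · have hnm : h ∉ (bundle (transfer X (X x) (h :: P)) k).erase x := by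
        simp [transfer, hxk]
      rwa [Finset.erase_eq_of_notMem hnm] at hind

section ShortestPath

variable {X : Allocation G n} {i : Fin n} {P : List G}

theorem IsShortestTransferPath.no_shortcut (hP : IsShortestTransferPath c v X i P)
    (A : List G) (y h : G) (B : List G) (e : P = A ++ y :: h :: B) (z : G) (hz : z ∈ B) :
    ¬ ExchangeEdge c v X y z := by
  subst e
  intro hyz
  obtain ⟨⟨hnd, hch, hhead, hlast⟩, hmin⟩ := hP
  obtain ⟨B₁, B₂, rfl⟩ := List.append_of_mem hz
  have hsub : (A ++ y :: z :: B₂).Sublist (A ++ y :: h :: (B₁ ++ z :: B₂)) := by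
    refine (List.Sublist.refl A).append (List.Sublist.cons_cons y ?_)
    exact (List.sublist_append_right B₁ _).cons h
  have := hmin (A ++ y :: z :: B₂) ⟨hnd.sublist hsub, ?_, ?_, ?_⟩
  · simp only [List.length_append, List.length_cons] at this
    omega
  · have h1 : (A ++ [y]).IsChain (ExchangeEdge c v X) := hch.prefix ⟨h :: (B₁ ++ z :: B₂), by simp⟩
    have h2 : (z :: B₂).IsChain (ExchangeEdge c v X) :=
      hch.suffix ⟨A ++ y :: h :: B₁, by simp⟩
    have h3 : A ++ y :: z :: B₂ = (A ++ [y]) ++ z :: B₂ := by simp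
    rw [h3, List.isChain_append]
    refine ⟨h1, h2, fun a ha b hb => ?_⟩
    have h4 : y = a := by simpa using ha
    have h5 : z = b := by simpa using hb
    rwa [← h4, ← h5]
  · cases A <;> simpa using hhead
  · simpa [List.getLast?_cons, List.getLast?_append] using hlast

theorem IsShortestTransferPath.notMem_gainSet {g : G} {Q : List G}
    (hP : IsShortestTransferPath c v X i (g :: Q)) (z : G) (hz : z ∈ Q) :
    z ∉ gainSet c v X i := by
  intro hzi
  obtain ⟨⟨hnd, hch, hhead, hlast⟩, hmin⟩ := hP
  obtain ⟨B₁, B₂, rfl⟩ := List.append_of_mem hz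
  have hsuf : z :: B₂ <:+ g :: (B₁ ++ z :: B₂) := ⟨g :: B₁, by simp⟩
  have := hmin (z :: B₂) ⟨hnd.sublist hsuf.sublist, hch.suffix hsuf, ⟨z, by simp, hzi⟩, ?_⟩
  · simp only [List.length_append, List.length_cons] at this
    omega
  · simpa [List.getLast?_cons, List.getLast?_append] using hlast

/-- A shortest path meets the dummy bundle in its last good only. -/
theorem IsShortestTransferPath.eq_last (hP : IsShortestTransferPath c v X i P) {z last : G}
    (hl : last ∈ P.getLast?) (hz : z ∈ P) (hz0 : X z = none) : z = last := by
  obtain ⟨⟨hnd, hch, hhead, hlast⟩, hmin⟩ := hP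
  obtain ⟨A, B, rfl⟩ := List.append_of_mem hz
  have hpre : A ++ [z] <+: A ++ z :: B := ⟨B, by simp⟩
  have := hmin (A ++ [z]) ⟨hnd.sublist hpre.sublist, hch.prefix hpre, ?_,
    ⟨z, by simp, by simpa using hz0⟩⟩
  · have hB : B = [] := by
      simp only [List.length_append, List.length_cons, List.length_nil] at this
      exact List.length_eq_zero_iff.1 (by omega)
    subst hB
    simpa using hl
  · cases A <;> simpa using hhead

theorem IsShortestTransferPath.last_eq_none (hP : IsShortestTransferPath c v X i P) {last : G}
    (hl : last ∈ P.getLast?) : X last = none := by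
  obtain ⟨g, hg, hg0⟩ := hP.1.last_mem
  rw [Option.mem_unique hl hg]
  simpa using hg0

theorem IsShortestTransferPath.clean_transfer (hc : 2 ≤ c)
    (hv : ∀ i, IsBivaluedSubmodular 1 c (v i)) (hX : Clean c v X)
    (hP : IsShortestTransferPath c v X i P) : Clean c v (transfer X (some i) P) := by
  intro k
  have hr := isRankFunction_extBeta hc hv k
  cases P with
  | nil => exact hX k
  | cons g Q =>
    have hind := indep_transfer_erase hc hv hX k g Q hP.1.nodup hP.1.chain
      fun A y h B e => hP.no_shortcut A y h B e
    have hsub : (bundle (transfer X (some i) (g :: Q)) k).erase g =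
        (bundle (transfer X (X g) Q) k).erase g := by
      ext z
      simp only [Finset.mem_erase, mem_bundle, transfer]
      exact and_congr_right fun hz => by rw [Function.update_of_ne hz]
    rw [← hsub] at hind
    by_cases hk : some i = k
    · have hmem : g ∈ bundle (transfer X (some i) (g :: Q)) k := by simp [transfer, hk]
      rw [← Finset.insert_erase hmem]
      refine hr.indep_insert hind (hr.not_span_of_span (S := bundle X k) ?_ ?_)
      · intro z hz
        rw [hsub] at hz
        rcases eq_or_mem_of_transfer_eq X _ Q (mem_bundle.1 (Finset.mem_of_mem_erase hz))
          with hz2 | hz2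
        · rw [Finset.insert_eq_of_mem (mem_bundle.2 hz2)]
        · have h1 := hP.notMem_gainSet z hz2
          have h2 := hr.insert_le (bundle X k) z
          have h3 := hr.mono (Finset.subset_insert z (bundle X k))
          simp only [gainSet, marginal, Set.mem_ofPred_eq, hk] at h1
          omega
      · obtain ⟨a, ha, hai⟩ := hP.1.head_mem
        have hga : g = a := by simpa using ha
        simp only [gainSet, marginal, Set.mem_ofPred_eq, ← hga, hk] at hai
        omega
    · have hnm : g ∉ bundle (transfer X (some i) (g :: Q)) k := by simp [transfer, hk]
      rwa [Finset.erase_eq_of_notMem hnm] at hind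

theorem IsShortestTransferPath.sizes_transfer (hP : IsShortestTransferPath c v X i P) :
    sizes (transfer X (some i) P) = sizes X + Pi.single i 1 := by
  obtain ⟨last, hl, -⟩ := hP.1.last_mem
  funext k
  have h := card_bundle_transfer X (some k) (some i) P hP.1.nodup last hl
  rw [hP.last_eq_none hl] at h
  simp only [reduceCtorEq, if_false, Option.some.injEq] at h
  simp only [sizes, Pi.add_apply, Pi.single_apply, eq_comm (a := k)]
  exact h

theorem IsShortestTransferPath.transfer_eq_none_iff (hP : IsShortestTransferPath c v X i P)
    {last : G} (hl : last ∈ P.getLast?) (g : G) :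
    transfer X (some i) P g = none ↔ X g = none ∧ g ≠ last := by
  have h := card_bundle_transfer X none (some i) P hP.1.nodup last hl
  rw [hP.last_eq_none hl] at h
  simp only [if_true, reduceCtorEq, if_false, add_zero] at h
  have hmem : last ∈ bundle X none := mem_bundle.2 (hP.last_eq_none hl)
  have hsub : (bundle X none).erase last ⊆ bundle (transfer X (some i) P) none := by
    intro z hz
    simp only [Finset.mem_erase, mem_bundle] at hz ⊢
    rw [transfer_of_notMem X _ P fun hzP => hz.1 (hP.eq_last hl hzP hz.2), hz.2]
  have heq := Finset.eq_of_subset_of_card_le hsub (by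
    have := Finset.card_erase_add_one hmem
    omega)
  rw [← mem_bundle, ← heq, Finset.mem_erase, mem_bundle, and_comm]

end ShortestPath

theorem exists_isShortestTransferPath {X : Allocation G n} {i : Fin n}
    (h : ∃ P, IsTransferPath c v X i P) : ∃ P, IsShortestTransferPath c v X i P := by
  classical
  have h' : ∃ l, ∃ P, IsTransferPath c v X i P ∧ P.length = l := by
    obtain ⟨P, hP⟩ := h
    exact ⟨_, P, hP, rfl⟩
  obtain ⟨P, hP, hl⟩ := Nat.find_spec h'
  exact ⟨P, hP, fun Q hQ => hl ▸ Nat.find_min' h' ⟨Q, hQ, rfl⟩⟩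

/-- A transfer path for `i` exists if and only if `i` can receive one more good of value `c` while
all agents keep their numbers of such goods. -/
theorem exists_path_iff (hc : 2 ≤ c) (hv : ∀ i, IsBivaluedSubmodular 1 c (v i))
    {X : Allocation G n} (hX : Clean c v X) (i : Fin n) :
    (∃ P, IsTransferPath c v X i P) ↔ sizes X + Pi.single i 1 ∈ cleanSizes c v := by
  constructor
  · intro h
    obtain ⟨P, hP⟩ := exists_isShortestTransferPath h
    exact ⟨_, hP.clean_transfer hc hv hX, hP.sizes_transfer⟩
  · rintro ⟨Z, hZ, hZs⟩
    by_contra h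
    obtain ⟨K, hK, htight⟩ := exists_tight_of_no_path hc hv hX {i} (by simpa using h)
    have h1 := htight Z hZ
    rw [hZs] at h1
    simp only [Pi.add_apply, Finset.sum_add_distrib, Finset.sum_pi_single',
      hK (Finset.mem_singleton_self i), if_true] at h1
    omega

/-- The tight sets of `exists_tight_of_no_path`, in terms of size vectors. -/
theorem exists_tight (hc : 2 ≤ c) (hv : ∀ i, IsBivaluedSubmodular 1 c (v i))
    {d : Fin n → ℕ} (hd : d ∈ cleanSizes c v) (J : Finset (Fin n))
    (hJ : ∀ i ∈ J, d + Pi.single i 1 ∉ cleanSizes c v) :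
    ∃ K : Finset (Fin n), J ⊆ K ∧ ∀ z ∈ cleanSizes c v, ∑ i ∈ K, z i ≤ ∑ i ∈ K, d i := by
  obtain ⟨X, hX, rfl⟩ := hd
  obtain ⟨K, hK, h⟩ := exists_tight_of_no_path hc hv hX J
    fun i hi => fun hp => hJ i hi ((exists_path_iff hc hv hX i).1 hp)
  refine ⟨K, hK, ?_⟩
  rintro z ⟨Z, hZ, rfl⟩
  exact h Z hZ

/-- The exchange property of size vectors of clean allocations. -/
theorem exists_exchange (hc : 2 ≤ c) (hv : ∀ i, IsBivaluedSubmodular 1 c (v i))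
    {d b : Fin n → ℕ} (hb : b ∈ cleanSizes c v) (hdb : d ≤ b) (hne : d ≠ b) {i : Fin n}
    (hdi : d + Pi.single i 1 ∈ cleanSizes c v) (hi : b i = d i) :
    ∃ j, j ≠ i ∧ d j < b j ∧
      ∃ b' ∈ cleanSizes c v, b' + Pi.single j 1 = b + Pi.single i 1 := by
  -- let `a` be maximal among the size vectors between `d + e_i` and `b + e_i`
  obtain ⟨a, ⟨haD, hda, hab⟩, hmax⟩ : ∃ a, (a ∈ cleanSizes c v ∧ d + Pi.single i 1 ≤ a ∧
      a ≤ b + Pi.single i 1) ∧ ∀ a', (a' ∈ cleanSizes c v ∧ d + Pi.single i 1 ≤ a' ∧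
      a' ≤ b + Pi.single i 1) → ∑ k, a' k ≤ ∑ k, a k := by
    have hfin : {a | a ∈ cleanSizes c v ∧ d + Pi.single i 1 ≤ a ∧
        a ≤ b + Pi.single i 1}.Finite :=
      (Set.finite_Iic (b + Pi.single i 1)).subset fun a ha => ha.2.2
    exact hfin.exists_maximalFor (fun a => ∑ k, a k) _
      ⟨d + Pi.single i 1, hdi, le_rfl, add_le_add_left hdb _⟩ |>.imp
        fun a ha => ⟨ha.1, fun a' ha' => (le_total _ _).elim (ha.2 ha') id⟩
  have hai : a i = b i + 1 := by
    have h1 := hda i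
    have h2 := hab i
    simp only [Pi.add_apply, Pi.single_eq_same] at h1 h2
    omega
  have hak : ∀ k, k ≠ i → d k ≤ a k ∧ a k ≤ b k := by
    intro k hk
    have h1 := hda k
    have h2 := hab k
    simp only [Pi.add_apply, Pi.single_eq_of_ne hk] at h1 h2
    omega
  by_cases hall : ∃ j, j ≠ i ∧ a j < b j
  swap
  · have hba : b + Pi.single i 1 = a := by
      push Not at hall
      funext k
      by_cases hk : k = i
      · subst hk; simp [hai]
      · simp only [Pi.add_apply, Pi.single_eq_of_ne hk]
        have := hall k hk
        have := (hak k hk).2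
        omega
    obtain ⟨j, hj⟩ : ∃ j, d j < b j := by
      by_contra h
      push Not at h
      exact hne (le_antisymm hdb h)
    have hji : j ≠ i := by rintro rfl; omega
    refine ⟨j, hji, hj, a - Pi.single j 1, cleanSizes_mono hc hv haD tsub_le_self, ?_⟩
    rw [hba]
    refine tsub_add_cancel_of_le fun k => ?_
    by_cases hk : k = j
    · subst hk
      rw [← hba]
      simp only [Pi.single_eq_same, Pi.add_apply]
      omega
    · simp [Pi.single_eq_of_ne hk]
  obtain ⟨j, hji, hj⟩ := hall
  refine ⟨j, hji, by have := hak j hji; omega, a, haD, ?_⟩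
  -- a tight set covering all `k` with `a_k < b_k` shows that `j` is the only deficient agent
  obtain ⟨K, hJK, hK⟩ := exists_tight hc hv haD
    (Finset.univ.filter fun k => k ≠ i ∧ a k < b k) (by
      intro k hk hmem
      rw [Finset.mem_filter] at hk
      have := hmax _ ⟨hmem, hda.trans (le_add_of_nonneg_right zero_le), fun l => ?_⟩
      · simp [Finset.sum_add_distrib] at this
      · have h1 := hab l
        by_cases hl : l = k
        · subst hl
          simp only [Pi.add_apply, Pi.single_eq_same, Pi.single_eq_of_ne hk.2.1]
          omega
        · simpa only [Pi.add_apply, Pi.single_eq_of_ne hl, add_zero] using h1)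
  have hle := hK b hb
  have hsum : ∀ k, k ∈ Kᶜ → b k ≤ a k := by
    intro k hk
    rw [Finset.mem_compl] at hk
    by_contra hlt
    push Not at hlt
    by_cases hki : k = i
    · subst hki; omega
    · exact hk (hJK (Finset.mem_filter.2 ⟨Finset.mem_univ _, hki, hlt⟩))
  have hsum' := Finset.sum_le_sum hsum
  have hjle : a + Pi.single j 1 ≤ b + Pi.single i 1 := by
    intro k
    by_cases hk : k = j
    · subst hk
      simp only [Pi.add_apply, Pi.single_eq_same]
      omega
    · simpa only [Pi.add_apply, Pi.single_eq_of_ne hk, add_zero] using hab k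
  have htot : ∑ k, (b + Pi.single i 1 : Fin n → ℕ) k ≤ ∑ k, (a + Pi.single j 1 : Fin n → ℕ) k := by
    have h1 := Finset.sum_add_sum_compl K b
    have h2 := Finset.sum_add_sum_compl K a
    simp only [Pi.add_apply, Finset.sum_add_distrib, Finset.sum_pi_single', Finset.mem_univ,
      if_true]
    omega
  by_contra hne'
  obtain ⟨k, hk⟩ : ∃ k, (a + Pi.single j 1 : Fin n → ℕ) k < (b + Pi.single i 1 : Fin n → ℕ) k := by
    by_contra h
    push Not at h
    exact hne' (le_antisymm hjle h)
  exact absurd htot (not_le.2 (Finset.sum_lt_sum (fun k _ => hjle k) ⟨k, Finset.mem_univ k, hk⟩))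

end Sizes

/-! ### Sorted vectors -/

section Sorted

variable {n : ℕ}

theorem sorted_le_iff (x : Fin n → ℕ) (k : Fin n) (t : ℕ) :
    sorted x k ≤ t ↔ (k : ℕ) < (Finset.univ.filter fun i => x i ≤ t).card := by
  have : (Finset.univ.filter fun i => sorted x i ≤ t).card =
      (Finset.univ.filter fun i => x i ≤ t).card :=
    Finset.card_equiv (Tuple.sort x) fun i => by
      rw [Finset.mem_filter, Finset.mem_filter]
      simp [sorted]
  rw [← this]
  exact (Tuple.lt_card_le_iff_apply_le_of_monotone (Tuple.monotone_sort x)).symm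

theorem sorted_mono {x y : Fin n → ℕ} (h : y ≤ x) (k : Fin n) : sorted y k ≤ sorted x k := by
  rw [sorted_le_iff]
  refine lt_of_lt_of_le ((sorted_le_iff x k _).1 le_rfl) (Finset.card_le_card fun i hi => ?_)
  rw [Finset.mem_filter] at hi ⊢
  exact ⟨hi.1, (h i).trans hi.2⟩

theorem sum_sorted (x : Fin n → ℕ) : ∑ k, sorted x k = ∑ k, x k :=
  Equiv.sum_comp (Tuple.sort x) x

theorem sorted_comp_perm (x : Fin n → ℕ) (σ : Equiv.Perm (Fin n)) :
    sorted (x ∘ σ) = sorted x :=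
  Tuple.comp_perm_comp_sort_eq_comp_sort

/-- Raising the `i`-th entry is a leximin improvement, even if entries above it are lowered,
provided that they stay above the old value of the `i`-th entry. -/
theorem lexDom_sorted {x y : Fin n → ℕ} (i : Fin n) (hi : x i < y i)
    (h : ∀ k, k ≠ i → y k = x k ∨ (x i < x k ∧ x i < y k)) :
    LexDom (sorted y) (sorted x) := by
  have hlow : ∀ s < x i, (Finset.univ.filter fun k => y k ≤ s) =
      Finset.univ.filter fun k => x k ≤ s := by
    intro s hs
    ext k
    simp only [Finset.mem_filter, Finset.mem_univ, true_and]
    by_cases hk : k = i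
    · subst hk; omega
    · rcases h k hk with h | h <;> omega
  have hlt : (Finset.univ.filter fun k => y k ≤ x i).card <
      (Finset.univ.filter fun k => x k ≤ x i).card := by
    refine Finset.card_lt_card ((Finset.ssubset_iff_of_subset fun k => ?_).2 ⟨i, ?_, ?_⟩)
    · simp only [Finset.mem_filter, Finset.mem_univ, true_and]
      by_cases hk : k = i
      · subst hk; omega
      · rcases h k hk with h | h <;> omega
    · simp
    · simpa using hi
  have hn : (Finset.univ.filter fun k => x k ≤ x i).card ≤ n := by
    simpa using Finset.card_filter_le Finset.univ fun k => x k ≤ x i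
  -- the sorted vectors first differ at the index `#{k | y k ≤ x i}`
  refine ⟨⟨_, hlt.trans_le hn⟩, fun j hj => ?_, ?_⟩
  · have hj' : (j : ℕ) < (Finset.univ.filter fun k => y k ≤ x i).card := hj
    have hy := (sorted_le_iff y j (x i)).2 hj'
    have hx := (sorted_le_iff x j (x i)).2 (hj'.trans hlt)
    have heq : ∀ s < x i, sorted y j ≤ s ↔ sorted x j ≤ s := by
      intro s hs
      rw [sorted_le_iff, sorted_le_iff, hlow s hs]
    rcases hy.lt_or_eq with h1 | h1
    · have h2 := (heq _ h1).1 le_rfl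
      have h3 := (heq _ (h2.trans_lt h1)).2 le_rfl
      omega
    · rcases hx.lt_or_eq with h2 | h2
      · have h3 := (heq _ h2).2 le_rfl
        omega
      · omega
  · have h1 := (sorted_le_iff x ⟨_, hlt.trans_le hn⟩ (x i)).2 hlt
    have h2 := mt (sorted_le_iff y ⟨_, hlt.trans_le hn⟩ (x i)).1 (lt_irrefl _)
    omega

end Sorted

/-! ### Optimal pairs of vectors -/

section Pairs

variable {n : ℕ}

/-- The utilities of agents who get `d` goods of value `c` and `e` goods of value `1`. -/
def util (c : ℕ) (d e : Fin n → ℕ) : Fin n → ℕ := fun k => c * d k + e k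

theorem util_add_left (c : ℕ) (d e : Fin n → ℕ) (i : Fin n) :
    util c (d + Pi.single i 1) e = addAt (util c d e) i c := by
  funext k
  by_cases hk : k = i
  · subst hk
    simp only [util, addAt, Pi.add_apply, Pi.single_eq_same, Function.update_self]
    ring
  · simp [util, addAt, Pi.single_eq_of_ne hk, Function.update_of_ne hk]

theorem util_add_right (c : ℕ) (d e : Fin n → ℕ) (i : Fin n) :
    util c d (e + Pi.single i 1) = addAt (util c d e) i 1 := by
  funext k
  by_cases hk : k = i
  · subst hk
    simp only [util, addAt, Pi.add_apply, Pi.single_eq_same, Function.update_self]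
    ring
  · simp [util, addAt, Pi.single_eq_of_ne hk, Function.update_of_ne hk]

theorem sum_add_single (d : Fin n → ℕ) (i : Fin n) (a : ℕ) :
    ∑ k, (d + Pi.single i a : Fin n → ℕ) k = ∑ k, d k + a := by
  simp [Finset.sum_add_distrib]

theorem exists_eq_add_single {e : Fin n → ℕ} {j : Fin n} {a : ℕ} (h : a ≤ e j) :
    ∃ e₀ : Fin n → ℕ, e = e₀ + Pi.single j a := by
  refine ⟨e - Pi.single j a, (tsub_add_cancel_of_le fun k => ?_).symm⟩
  by_cases hk : k = j
  · subst hk; simpa using h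
  · simp [Pi.single_eq_of_ne hk]

theorem add_single_le {d b : Fin n → ℕ} (h : d ≤ b) {i : Fin n} (hi : d i < b i) :
    d + Pi.single i 1 ≤ b := by
  intro k
  by_cases hk : k = i
  · subst hk; simpa using hi
  · simpa [Pi.single_eq_of_ne hk] using h k

/-- The domination order, in terms of the numbers of goods of value `c` and `1`. -/
def PairDom (c : ℕ) (d' e' d e : Fin n → ℕ) : Prop :=
  LexDom (sorted (util c d' 0)) (sorted (util c d 0)) ∨
    (sorted (util c d' 0) = sorted (util c d 0) ∧ LexDom (util c d' 0) (util c d 0)) ∨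
    (util c d' 0 = util c d 0 ∧ LexDom (util c d' e') (util c d e))

/-- Numbers `d` and `e` of goods of value `c` and `1` that do not exceed what can be allocated,
where `D` is the set of possible vectors `d` and `m` the number of goods. -/
def Feasible (D : Set (Fin n → ℕ)) (m : ℕ) (d e : Fin n → ℕ) : Prop :=
  d ∈ D ∧ ∑ k, d k + ∑ k, e k ≤ m

/-- A feasible pair whose utility vector is a best one, and that is undominated among such pairs. -/
def IsBest (Ψ : JusticeCriterion n) (c : ℕ) (D : Set (Fin n → ℕ)) (m : ℕ) (d e : Fin n → ℕ) :
    Prop :=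
  Feasible D m d e ∧ ∀ d' e', Feasible D m d' e' → Ψ.ge (util c d' e') (util c d e) →
    Ψ.ge (util c d e) (util c d' e') ∧ ¬ PairDom c d' e' d e

theorem toLex_lt_of_lexDom {x y : Fin n → ℕ} (h : LexDom y x) : toLex x < toLex y := by
  obtain ⟨k, h1, h2⟩ := h
  exact ⟨k, fun j hj => (h1 j hj).symm, h2⟩

theorem JusticeCriterion.exists_best (Ψ : JusticeCriterion n) {α : Type*} (f : α → Fin n → ℕ)
    {S : Set α} (hS : S.Finite) (hne : S.Nonempty) : ∃ a ∈ S, ∀ b ∈ S, Ψ.ge (f a) (f b) := by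
  induction S, hS using Set.Finite.induction_on with
  | empty => exact absurd hne Set.not_nonempty_empty
  | @insert a S _ _ ih =>
    have hrefl : ∀ x, Ψ.ge x x := fun x => (Ψ.total x x).elim id id
    rcases S.eq_empty_or_nonempty with rfl | hS
    · exact ⟨a, by simp, by simp [hrefl]⟩
    · obtain ⟨b, hb, hbS⟩ := ih hS
      rcases Ψ.total (f a) (f b) with h | h
      · refine ⟨a, Set.mem_insert _ _, fun x hx => ?_⟩
        rcases hx with rfl | hx
        · exact hrefl _
        · exact Ψ.trans _ _ _ h (hbS x hx)
      · refine ⟨b, Set.mem_insert_of_mem _ hb, fun x hx => ?_⟩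
        rcases hx with rfl | hx
        · exact h
        · exact hbS x hx

theorem exists_isBest (Ψ : JusticeCriterion n) (c : ℕ) (D : Set (Fin n → ℕ)) (m : ℕ)
    (h0 : 0 ∈ D) : ∃ d e, IsBest Ψ c D m d e := by
  let S : Set ((Fin n → ℕ) × (Fin n → ℕ)) := {p | Feasible D m p.1 p.2}
  have hS : S.Finite := by
    refine ((Set.finite_Iic fun _ => m).prod (Set.finite_Iic fun _ => m)).subset ?_
    rintro ⟨d, e⟩ ⟨-, h⟩
    have hle : ∀ (x : Fin n → ℕ) k, x k ≤ ∑ k, x k := fun x k =>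
      Finset.single_le_sum (f := x) (fun _ _ => Nat.zero_le _) (Finset.mem_univ k)
    constructor <;> intro k
    · have := hle d k
      dsimp only at h ⊢
      omega
    · have := hle e k
      dsimp only at h ⊢
      omega
  obtain ⟨p, hp, hpS⟩ := Ψ.exists_best (fun p => util c p.1 p.2) hS
    ⟨(0, 0), h0, by simp⟩
  -- among the `Ψ`-best pairs take one that is maximal in the linear order behind `PairDom`
  obtain ⟨q, ⟨hq, hqp⟩, hmax⟩ := (hS.subset (Set.sep_subset S fun q =>
    Ψ.ge (util c q.1 q.2) (util c p.1 p.2))).exists_maximalFor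
    (fun q => toLex (toLex (sorted (util c q.1 0)),
      toLex (toLex (util c q.1 0), toLex (util c q.1 q.2)))) _ ⟨p, hp, hpS p hp⟩
  refine ⟨q.1, q.2, hq, fun d' e' hf hge => ⟨Ψ.trans _ _ _ hqp (hpS (d', e') hf), fun hdom => ?_⟩⟩
  refine not_le_of_gt ?_ (hmax (j := (d', e')) ⟨hf, Ψ.trans _ _ _ hge hqp⟩ (le_of_lt ?_)) <;>
  · simp only [Prod.Lex.toLex_lt_toLex]
    rcases hdom with h | ⟨h1, h2⟩ | ⟨h1, h2⟩
    · exact Or.inl (toLex_lt_of_lexDom h)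
    · exact Or.inr ⟨congrArg toLex h1.symm, Or.inl (toLex_lt_of_lexDom h2)⟩
    · exact Or.inr ⟨congrArg (fun x => toLex (sorted x)) h1.symm,
        Or.inr ⟨congrArg toLex h1.symm, toLex_lt_of_lexDom h2⟩⟩

/-! ### Local optimality of best pairs -/

variable {c m : ℕ} {D : Set (Fin n → ℕ)} {Ψ : JusticeCriterion n}
  {φ : (Fin n → ℕ) → Fin n → ℕ → ℝ}

theorem ge_of_sorted_eq (hΨ : Ψ.SymmetricParetoDominance) {x y : Fin n → ℕ}
    (h : sorted x = sorted y) : Ψ.ge x y :=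
  (hΨ x y fun i => (congrFun h i).ge).1

theorem not_ge_of_lt (hΨ : Ψ.SymmetricParetoDominance) {x y : Fin n → ℕ} (h : y < x) :
    Ψ.ge x y ∧ ¬ Ψ.ge y x := by
  obtain ⟨h1, h2⟩ := hΨ x y (sorted_mono h.le)
  refine ⟨h1, fun h3 => ?_⟩
  have h4 := h2.1 ⟨h1, h3⟩
  have h5 : ∑ k, y k < ∑ k, x k := Fintype.sum_strictMono h
  rw [← sum_sorted x, ← sum_sorted y, h4] at h5
  exact lt_irrefl _ h5

theorem addAt_lt_addAt (x : Fin n → ℕ) (i : Fin n) {a b : ℕ} (h : a < b) :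
    addAt x i a < addAt x i b := by
  refine Pi.lt_def.2 ⟨fun k => ?_, i, by simpa [addAt] using h⟩
  by_cases hk : k = i
  · subst hk; simpa [addAt] using h.le
  · simp [addAt, Function.update_of_ne hk]

theorem IsGainFunction.one_lt (hc : 2 ≤ c) (hΨ : Ψ.SymmetricParetoDominance)
    (hφ : IsGainFunction Ψ c φ) (x : Fin n → ℕ) (i : Fin n) : φ x i 1 < φ x i c := by
  by_contra h
  exact (not_ge_of_lt hΨ (addAt_lt_addAt x i (by omega : 1 < c))).2
    (hφ.G1 x i i 1 c (Or.inl rfl) (Or.inr rfl) (not_lt.1 h)).1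

/-- A best pair uses up all goods, as any agent benefits from one more good of value `1`. -/
theorem IsBest.sum_eq (hΨ : Ψ.SymmetricParetoDominance) {d e : Fin n → ℕ}
    (hb : IsBest Ψ c D m d e) (i : Fin n) : ∑ k, d k + ∑ k, e k = m := by
  refine le_antisymm hb.1.2 (not_lt.1 fun hlt => ?_)
  have hu : util c d e < util c d (e + Pi.single i 1) := by
    refine Pi.lt_def.2 ⟨fun k => by simp [util], i, by simp [util]⟩
  obtain ⟨h1, h2⟩ := not_ge_of_lt hΨ hu
  exact h2 (hb.2 d (e + Pi.single i 1) ⟨hb.1.1, by rw [sum_add_single]; omega⟩ h1).1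

theorem lexDom_sorted_add_single (hc : 2 ≤ c) (d : Fin n → ℕ) (i : Fin n) :
    LexDom (sorted (util c (d + Pi.single i 1) 0)) (sorted (util c d 0)) := by
  refine lexDom_sorted i ?_ fun k hk => Or.inl (by simp [util, Pi.single_eq_of_ne hk])
  simp [util, mul_add]
  omega

/-- In a best pair no good of value `1` is better replaced by one of value `c`. -/
theorem IsBest.gain_lt_of_replace (hc : 2 ≤ c) (hφ : IsGainFunction Ψ c φ) {d e : Fin n → ℕ}
    {i j : Fin n} (hb : IsBest Ψ c D m d (e + Pi.single j 1)) (hd : d + Pi.single i 1 ∈ D) :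
    φ (util c d e) i c < φ (util c d e) j 1 := by
  by_contra h
  have hge := (hφ.G1 _ i j c 1 (Or.inr rfl) (Or.inl rfl) (not_lt.1 h)).1
  rw [← util_add_left, ← util_add_right] at hge
  have hsum := hb.1.2
  rw [sum_add_single] at hsum
  exact (hb.2 _ _ ⟨hd, by rw [sum_add_single]; omega⟩ hge).2
    (Or.inl (lexDom_sorted_add_single hc d i))

/-- In a best pair no good of value `1` is better moved to another agent. -/
theorem IsBest.gain_le_of_move_one (hφ : IsGainFunction Ψ c φ) {d e : Fin n → ℕ}
    {i j : Fin n} (hb : IsBest Ψ c D m d (e + Pi.single j 1)) :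
    φ (util c d e) i 1 ≤ φ (util c d e) j 1 ∧
      (φ (util c d e) i 1 = φ (util c d e) j 1 → j ≤ i) := by
  have hf : Feasible D m d (e + Pi.single i 1) :=
    ⟨hb.1.1, by have := hb.1.2; rw [sum_add_single] at this ⊢; exact this⟩
  have key : φ (util c d e) j 1 ≤ φ (util c d e) i 1 →
      φ (util c d e) i 1 = φ (util c d e) j 1 ∧ j ≤ i := by
    intro h
    have h1 := hφ.G1 _ i j 1 1 (Or.inl rfl) (Or.inl rfl) h
    rw [← util_add_right, ← util_add_right] at h1
    obtain ⟨h2, h3⟩ := hb.2 _ _ hf h1.1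
    refine ⟨h1.2.1 ⟨h1.1, h2⟩, not_lt.1 fun hij => h3 (Or.inr (Or.inr ⟨rfl, i, ?_, ?_⟩))⟩
    · intro k hk
      simp [util, Pi.single_eq_of_ne hk.ne, Pi.single_eq_of_ne (hk.trans hij).ne]
    · simp [util, Pi.single_eq_of_ne hij.ne]
  exact ⟨not_lt.1 fun h => absurd (key h.le).1 (ne_of_gt h), fun h => (key h.ge).2⟩

/-- In a best pair no good of value `c` is better used as a good of value `1`. -/
theorem IsBest.gain_le_of_replace (hφ : IsGainFunction Ψ c φ)
    {d e : Fin n → ℕ} {i j : Fin n} (hb : IsBest Ψ c D m (d + Pi.single j 1) e) (hd : d ∈ D) :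
    φ (util c d e) i 1 ≤ φ (util c d e) j c := by
  by_contra h
  have h1 := hφ.G1 _ i j 1 c (Or.inl rfl) (Or.inr rfl) (not_le.1 h).le
  rw [← util_add_left, ← util_add_right] at h1
  have hsum := hb.1.2
  rw [sum_add_single] at hsum
  have h2 := (hb.2 _ _ ⟨hd, by rw [sum_add_single]; omega⟩ h1.1).1
  exact h (h1.2.1 ⟨h1.1, h2⟩).le

/-- In a best pair no good of value `c` can be moved to an agent with fewer such goods, or to an
agent of smaller index if this permutes the numbers of such goods.  In the first case, the move
might decrease the welfare if the receiver has many goods of value `1`; then `c` of these are moved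
in the opposite direction, so that the utilities do not change at all. -/
theorem IsBest.not_move (hc : 2 ≤ c) (hΨ : Ψ.SymmetricParetoDominance)
    (hφ : IsGainFunction Ψ c φ) {d e : Fin n → ℕ} {i j : Fin n} (hij : i ≠ j)
    (hb : IsBest Ψ c D m (d + Pi.single j 1) e) (hd : d + Pi.single i 1 ∈ D) (hle : d i ≤ d j)
    (htie : d i = d j → i < j) : False := by
  have hsum := hb.1.2
  rw [sum_add_single] at hsum
  rcases hle.eq_or_lt with heq | hlt
  · have hsw : (d + Pi.single i 1 : Fin n → ℕ) =
        (d + Pi.single j 1 : Fin n → ℕ) ∘ Equiv.swap i j := by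
      funext k
      by_cases hki : k = i
      · subst hki; simp [heq]
      by_cases hkj : k = j
      · subst hkj; simp [heq, Pi.single_eq_of_ne hij, Pi.single_eq_of_ne hij.symm]
      · simp [Equiv.swap_apply_of_ne_of_ne hki hkj, Pi.single_eq_of_ne hki,
          Pi.single_eq_of_ne hkj]
    have hu : ∀ f : Fin n → ℕ, sorted (util c (d + Pi.single i 1) (f ∘ Equiv.swap i j)) =
        sorted (util c (d + Pi.single j 1) f) := by
      intro f
      rw [hsw, ← sorted_comp_perm (util c (d + Pi.single j 1) f) (Equiv.swap i j)]
      rfl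
    refine (hb.2 _ (e ∘ Equiv.swap i j) ⟨hd, ?_⟩ (ge_of_sorted_eq hΨ (hu e))).2
      (Or.inr (Or.inl ⟨hu 0, i, fun k hk => ?_, ?_⟩))
    · rw [sum_add_single]
      have : ∑ k, (e ∘ Equiv.swap i j) k = ∑ k, e k := Equiv.sum_comp (Equiv.swap i j) e
      omega
    · simp [util, Pi.single_eq_of_ne hk.ne, Pi.single_eq_of_ne (hk.trans (htie heq)).ne]
    · simp [util, Pi.single_eq_of_ne hij, mul_add]
      omega
  · have hlex : LexDom (sorted (util c (d + Pi.single i 1) 0))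
        (sorted (util c (d + Pi.single j 1) 0)) := by
      refine lexDom_sorted i ?_ fun k hki => ?_
      · simp [util, Pi.single_eq_of_ne hij, mul_add]
        omega
      · by_cases hkj : k = j
        · subst hkj
          right
          simp only [util, Pi.add_apply, Pi.single_eq_of_ne hij, Pi.single_eq_of_ne hki,
            Pi.single_eq_same, Pi.zero_apply, add_zero]
          exact ⟨Nat.mul_lt_mul_of_pos_left (by omega) (by omega),
            Nat.mul_lt_mul_of_pos_left hlt (by omega)⟩
        · left
          simp [util, Pi.single_eq_of_ne hki, Pi.single_eq_of_ne hkj]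
    rcases le_or_gt (util c d e i) (util c d e j) with h | h
    · have hge := (hφ.G1 _ i j c c (Or.inr rfl) (Or.inr rfl)
        (hφ.G3 _ i j c (Or.inr rfl) h).1).1
      rw [← util_add_left, ← util_add_left] at hge
      exact (hb.2 _ _ ⟨hd, by rw [sum_add_single]; omega⟩ hge).2 (Or.inl hlex)
    · have hei : c ≤ e i := by
        have h1 : c * (d i + 1) ≤ c * d j := Nat.mul_le_mul_left c hlt
        simp only [util, mul_add] at h h1
        omega
      obtain ⟨f, rfl⟩ := exists_eq_add_single hei
      have hu : util c (d + Pi.single i 1) (f + Pi.single j c) =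
          util c (d + Pi.single j 1) (f + Pi.single i c) := by
        funext k
        simp only [util, Pi.add_apply, Pi.single_apply]
        split_ifs <;> ring
      rw [sum_add_single] at hsum
      exact (hb.2 _ _ ⟨hd, by rw [sum_add_single, sum_add_single]; omega⟩
        (ge_of_sorted_eq hΨ (congrArg sorted hu))).2 (Or.inl hlex)

end Pairs

/-! ### The greedy steps stay below a best pair -/

section Greedy

variable {G : Type*} [Fintype G] [DecidableEq G] {n : ℕ} {c : ℕ} {v : Fin n → Finset G → ℕ}
  {Ψ : JusticeCriterion n} {φ : (Fin n → ℕ) → Fin n → ℕ → ℝ} {d e d' e' : Fin n → ℕ}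
  {U : Finset (Fin n)} {i : Fin n}

/-- If the algorithm, with `d` and `e` goods of value `c` and `1` allocated, gives a good of value
`c` to agent `i`, then a best pair `(d', e')` above `(d, e)` gives such a good to `i`, too. -/
theorem IsBest.add_single_le_left (hc : 2 ≤ c) (hv : ∀ i, IsBivaluedSubmodular 1 c (v i))
    (hΨ : Ψ.SymmetricParetoDominance) (hφ : IsGainFunction Ψ c φ)
    (hb : IsBest Ψ c (cleanSizes c v) (Fintype.card G) d' e') (hd : d ≤ d') (he : e ≤ e')
    (hU : ∀ k ∈ U, e k = 0) (hsat : ∀ k ∉ U, d + Pi.single k 1 ∉ cleanSizes c v)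
    (hi : IsLeastArgmax U (fun k => φ (util c d e) k c) i)
    (hgain : ∀ k ∉ U, φ (util c d e) k 1 ≤ φ (util c d e) i c)
    (hdi : d + Pi.single i 1 ∈ cleanSizes c v)
    (hlt : ∑ k, d k + ∑ k, e k < Fintype.card G) : d + Pi.single i 1 ≤ d' := by
  by_contra hcon
  have hdi' : d' i = d i :=
    le_antisymm (not_lt.1 fun h => hcon (add_single_le hd h)) (hd i)
  by_cases hdd : d = d'
  · subst hdd
    -- the best pair has a good of value `1` that the current pair lacks; as `d + e_i` is possible,
    -- replacing it by a good of value `c` for `i` is an improvement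
    have hei : e' i = 0 := by
      by_contra h
      obtain ⟨f, rfl⟩ := exists_eq_add_single (Nat.one_le_iff_ne_zero.2 h)
      exact lt_asymm (hb.gain_lt_of_replace hc hφ hdi) (hφ.one_lt hc hΨ _ i)
    obtain ⟨j, hj⟩ : ∃ j, e j < e' j := by
      by_contra h
      push Not at h
      have h1 := hb.sum_eq hΨ i
      rw [le_antisymm he h] at hlt
      omega
    have hji : i ≠ j := by rintro rfl; omega
    obtain ⟨f, rfl⟩ := exists_eq_add_single (show 1 ≤ e' j by omega)
    have h1 := hb.gain_lt_of_replace hc hφ hdi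
    simp only [Pi.add_apply, Pi.single_eq_same, Pi.single_eq_of_ne hji] at hj hei
    have h2 : φ (util c d f) i c = φ (util c d e) i c :=
      (hφ.G2 _ _ i c (Or.inr rfl) (by simp [util]; omega)).2 (by
        simp only [util, hU i hi.1]; omega)
    have h3 : φ (util c d f) j 1 ≤ φ (util c d e) j 1 :=
      (hφ.G2 _ _ j 1 (Or.inl rfl) (by simp [util]; omega)).1
    by_cases hjU : j ∈ U
    · have h4 := hφ.one_lt hc hΨ (util c d e) j
      have h5 := hi.2.1 j hjU
      linarith
    · have := hgain j hjU
      linarith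
  · obtain ⟨j, hji, hj, b, hbD, hbj⟩ := exists_exchange hc hv hb.1.1 hd hdd hdi hdi'
    have hjU : j ∈ U := by
      by_contra h
      exact hsat j h (cleanSizes_mono hc hv hb.1.1 (add_single_le hd hj))
    obtain ⟨f, rfl⟩ := exists_eq_add_single (show 1 ≤ d' j by omega)
    have hbf : b = f + Pi.single i 1 := by
      have : b + Pi.single j 1 = f + Pi.single i 1 + Pi.single j 1 := by rw [hbj]; abel
      exact add_right_cancel this
    simp only [Pi.add_apply, Pi.single_eq_same, Pi.single_eq_of_ne hji.symm] at hj hdi'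
    have hmax := hi.2.1 j hjU
    have hui : util c d e i = c * d i := by simp [util, hU i hi.1]
    have huj : util c d e j = c * d j := by simp [util, hU j hjU]
    have hle : d i ≤ d j := by
      by_contra h
      have h1 : util c d e j ≤ util c d e i := by
        rw [hui, huj]
        exact Nat.mul_le_mul_left c (by omega)
      have h2 := hφ.G3 (util c d e) j i c (Or.inr rfl) h1
      have h3 := h2.2.1 (le_antisymm hmax h2.1)
      rw [hui, huj] at h3
      have := Nat.eq_of_mul_eq_mul_left (by omega) h3
      omega
    refine hb.not_move hc hΨ hφ hji.symm (hbf ▸ hbD) (by omega) fun h => ?_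
    have h1 : util c d e i = util c d e j := by
      rw [hui, huj]
      congr 1
      omega
    have h2 := (hφ.G3 (util c d e) i j c (Or.inr rfl) h1.le).2.2 h1
    exact lt_of_le_of_ne (hi.2.2 j hjU h2.symm) hji.symm

/-- If the algorithm, with `d` and `e` goods of value `c` and `1` allocated, gives a good of value
`1` to agent `i`, then a best pair `(d', e')` above `(d, e)` gives such a good to `i`, too. -/
theorem IsBest.add_single_le_right (hc : 2 ≤ c) (hv : ∀ i, IsBivaluedSubmodular 1 c (v i))
    (hΨ : Ψ.SymmetricParetoDominance) (hφ : IsGainFunction Ψ c φ)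
    (hb : IsBest Ψ c (cleanSizes c v) (Fintype.card G) d' e') (hd : d ≤ d') (he : e ≤ e')
    (hsat : ∀ k ∉ U, d + Pi.single k 1 ∉ cleanSizes c v)
    (hi : IsLeastArgmax (Finset.univ \ U) (fun k => φ (util c d e) k 1) i)
    (hgain : ∀ k ∈ U, φ (util c d e) k c < φ (util c d e) i 1)
    (hlt : ∑ k, d k + ∑ k, e k < Fintype.card G) : e + Pi.single i 1 ≤ e' := by
  by_contra hcon
  have hei : e' i = e i :=
    le_antisymm (not_lt.1 fun h => hcon (add_single_le he h)) (he i)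
  have hdU : ∀ j, d j < d' j → j ∈ U := by
    intro j hj
    by_contra h
    exact hsat j h (cleanSizes_mono hc hv hb.1.1 (add_single_le hd hj))
  have hiU : i ∉ U := (Finset.mem_sdiff.1 hi.1).2
  have hdi : d' i = d i := le_antisymm (not_lt.1 fun h => hiU (hdU i h)) (hd i)
  by_cases hex : ∃ j, e j < e' j
  · obtain ⟨j, hj⟩ := hex
    have hji : i ≠ j := by rintro rfl; omega
    obtain ⟨f, rfl⟩ := exists_eq_add_single (show 1 ≤ e' j by omega)
    obtain ⟨h1, h2⟩ := hb.gain_le_of_move_one hφ (i := i)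
    simp only [Pi.add_apply, Pi.single_eq_same, Pi.single_eq_of_ne hji] at hj hei
    have h3 : φ (util c d' f) i 1 = φ (util c d e) i 1 :=
      (hφ.G2 _ _ i 1 (Or.inl rfl) (by simp only [util, hdi]; omega)).2 (by
        simp only [util, hdi]; omega)
    have h4 : φ (util c d' f) j 1 ≤ φ (util c d e) j 1 :=
      (hφ.G2 _ _ j 1 (Or.inl rfl) (add_le_add (Nat.mul_le_mul_left c (hd j)) (by omega))).1
    by_cases hjU : j ∈ U
    · have h5 := hφ.one_lt hc hΨ (util c d e) j
      have h6 := hgain j hjU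
      linarith
    · have hjU' : j ∈ Finset.univ \ U := by simp [hjU]
      have h5 := hi.2.1 j hjU'
      dsimp only at h5
      have h6 := hi.2.2 j hjU' (by dsimp only; linarith)
      exact hji (le_antisymm h6 (h2 (by linarith)))
  · push Not at hex
    have hee := le_antisymm he hex
    subst hee
    obtain ⟨j, hj⟩ : ∃ j, d j < d' j := by
      by_contra h
      push Not at h
      have h1 := hb.sum_eq hΨ i
      rw [le_antisymm hd h] at hlt
      omega
    have hjU := hdU j hj
    have hji : i ≠ j := by rintro rfl; exact hiU hjU
    obtain ⟨f, rfl⟩ := exists_eq_add_single (show 1 ≤ d' j by omega)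
    have h1 := hb.gain_le_of_replace hφ (i := i)
      (cleanSizes_mono hc hv hb.1.1 (le_add_of_nonneg_right zero_le))
    simp only [Pi.add_apply, Pi.single_eq_same, Pi.single_eq_of_ne hji] at hj hdi
    have h2 : φ (util c f e) i 1 = φ (util c d e) i 1 :=
      (hφ.G2 _ _ i 1 (Or.inl rfl) (by simp only [util]; rw [← hdi]; simp)).2
        (by simp only [util]; rw [← hdi]; simp)
    have h3 : φ (util c f e) j c ≤ φ (util c d e) j c :=
      (hφ.G2 _ _ j c (Or.inr rfl)
        (add_le_add (Nat.mul_le_mul_left c (by omega)) le_rfl)).1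
    have h4 := hgain j hjU
    linarith

end Greedy

/-! ### Runs of Bivalued Yankee Swap -/

section Argmax

variable {n : ℕ} {A : Finset (Fin n)} {f : Fin n → ℝ}

theorem le_maxGain {k : Fin n} (hk : k ∈ A) : (f k : WithBot ℝ) ≤ maxGain A f :=
  Finset.le_sup (f := fun k => (f k : WithBot ℝ)) hk

theorem IsLeastArgmax.maxGain_eq {i : Fin n} (hi : IsLeastArgmax A f i) :
    maxGain A f = f i :=
  le_antisymm (Finset.sup_le fun k hk => WithBot.coe_le_coe.2 (hi.2.1 k hk)) (le_maxGain hi.1)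

theorem exists_isLeastArgmax (hA : A.Nonempty) : ∃ i, IsLeastArgmax A f i := by
  classical
  obtain ⟨j, hj, hmax⟩ := A.exists_max_image f hA
  have hne : (A.filter fun k => f k = f j).Nonempty := ⟨j, by simp [hj]⟩
  have hmem := Finset.min'_mem _ hne
  rw [Finset.mem_filter] at hmem
  refine ⟨_, hmem.1, fun k hk => (hmax k hk).trans_eq hmem.2.symm, fun k hk hfk => ?_⟩
  exact Finset.min'_le _ _ (Finset.mem_filter.2 ⟨hk, hfk.trans hmem.2⟩)

end Argmax

section Runs

variable {G : Type*} [Fintype G] [DecidableEq G] {n : ℕ} {c : ℕ} {v : Fin n → Finset G → ℕ}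
  {Ψ : JusticeCriterion n} {φ : (Fin n → ℕ) → Fin n → ℕ → ℝ} {d e : Fin n → ℕ}

theorem sizes_update {X : Allocation G n} {g : G} (hg : X g = none) (i : Fin n) :
    sizes (Function.update X g (some i)) = sizes X + Pi.single i 1 := by
  funext k
  have h := card_bundle_transfer X (some k) (some i) [g] (by simp) g (by simp)
  rw [hg] at h
  simp only [reduceCtorEq, if_false, Option.some.injEq, transfer] at h
  simp only [sizes, Pi.add_apply, Pi.single_apply, eq_comm (a := k)]
  exact h

theorem clean_update (hc : 2 ≤ c) (hv : ∀ i, IsBivaluedSubmodular 1 c (v i))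
    {X : Allocation G n} (hX : Clean c v X) {g : G} {i : Fin n}
    (h : extBeta c v (some i) (insert g (bundle X (some i))) ≠
      extBeta c v (some i) (bundle X (some i))) :
    Clean c v (Function.update X g (some i)) := by
  intro k
  have hr := isRankFunction_extBeta hc hv k
  by_cases hk : k = some i
  · subst hk
    have : bundle (Function.update X g (some i)) (some i) = insert g (bundle X (some i)) := by
      ext x
      by_cases hx : x = g
      · subst hx; simp
      · simp [hx]
    rw [this]
    exact hr.indep_insert (hX _) h
  · refine hr.indep_subset (fun x hx => ?_) (hX k)
    rw [mem_bundle] at hx ⊢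
    by_cases hxg : x = g
    · subst hxg
      rw [Function.update_self] at hx
      exact absurd hx.symm hk
    · rwa [Function.update_of_ne hxg] at hx

theorem Repair.sizes_eq {Xc X1 X1' : Allocation G n} {last : G} (h : Repair Xc last X1 X1') :
    sizes X1' = sizes X1 := by
  cases h with
  | keep => rfl
  | replace j h g hgc hg1 =>
    have hne : g ≠ last := by
      rintro rfl
      rw [hg1] at h
      exact absurd h (by simp)
    rw [sizes_update (by rw [Function.update_of_ne hne, hg1])]
    have h1 := sizes_update (X := Function.update X1 last none) (g := last) (by simp) j
    rw [Function.update_idem, ← h, Function.update_eq_self] at h1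
    exact h1.symm

/-- The invariant of the algorithm, relative to a best pair `(d, e)`: only agents who cannot
receive any more goods of value `c` have left `U`, only such agents hold goods of value `1`, and
the current allocation stays below the best pair. -/
structure Invariant (c : ℕ) (v : Fin n → Finset G → ℕ) (d e : Fin n → ℕ) (s : State G n) :
    Prop where
  clean : Clean c v s.Xc
  supp : ∀ g, s.X1 g ≠ none → s.Xc g = none
  active : ∀ i ∈ s.U, sizes s.X1 i = 0
  saturated : ∀ i ∉ s.U, sizes s.Xc + Pi.single i 1 ∉ cleanSizes c v
  le_left : sizes s.Xc ≤ d
  le_right : sizes s.X1 ≤ e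

theorem Invariant.bundle_alloc {s : State G n} (hs : Invariant c v d e s) (i : Fin n) :
    bundle s.alloc (some i) = bundle s.Xc (some i) ∪ bundle s.X1 (some i) := by
  ext g
  simp only [Finset.mem_union, mem_bundle, State.alloc, union, Option.or_eq_some_iff]
  exact or_congr_right ⟨fun h => h.2, fun h => ⟨hs.supp g (by simp [h]), h⟩⟩

/-- The goods of `X1` are worth `1` to their owners: otherwise the owner could receive another good
of value `c`. -/
theorem Invariant.extBeta_alloc (hc : 2 ≤ c) (hv : ∀ i, IsBivaluedSubmodular 1 c (v i))
    {s : State G n} (hs : Invariant c v d e s) (i : Fin n) :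
    extBeta c v (some i) (bundle s.alloc (some i)) = sizes s.Xc i := by
  rw [hs.bundle_alloc, (isRankFunction_extBeta hc hv (some i)).rank_union_of_span,
    hs.clean (some i)]
  · rfl
  intro g hg
  by_contra h
  have hg1 : s.X1 g = some i := mem_bundle.1 hg
  have hU : i ∈ s.U := by
    by_contra hU
    refine hs.saturated i hU ⟨_, clean_update hc hv hs.clean h, sizes_update ?_ i⟩
    exact hs.supp g (by simp [hg1])
  have h0 := hs.active i hU
  rw [sizes, Finset.card_eq_zero] at h0
  rw [h0] at hg
  exact absurd hg (Finset.notMem_empty g)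

theorem Invariant.utility_eq (hc : 2 ≤ c) (hv : ∀ i, IsBivaluedSubmodular 1 c (v i))
    {s : State G n} (hs : Invariant c v d e s) :
    utility v s.alloc = util c (sizes s.Xc) (sizes s.X1) := by
  funext i
  have hdisj : Disjoint (bundle s.Xc (some i)) (bundle s.X1 (some i)) := by
    refine Finset.disjoint_left.2 fun g hg hg1 => ?_
    rw [mem_bundle] at hg hg1
    have := hs.supp g (by simp [hg1])
    rw [hg] at this
    exact absurd this (by simp)
  rw [utility, val_eq hc hv, hs.extBeta_alloc hc hv, hs.bundle_alloc,
    Finset.card_union_of_disjoint hdisj]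
  obtain ⟨k, rfl⟩ : ∃ k, c = k + 1 := ⟨c - 1, by omega⟩
  simp only [util, sizes, Nat.add_sub_cancel]
  ring

omit [DecidableEq G] in
theorem State.Guard.sum_lt {s : State G n} (hs : s.Guard) :
    ∑ k, sizes s.Xc k + ∑ k, sizes s.X1 k < Fintype.card G := by
  have h1 := sum_card_bundle s.Xc
  have h2 : ∑ k, sizes s.X1 k < (bundle s.Xc none).card := hs
  omega

theorem State.Guard.exists_unallocated {s : State G n} (hs : s.Guard) :
    ∃ g, s.Xc g = none ∧ s.X1 g = none := by
  by_contra h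
  push Not at h
  have h1 := sum_card_bundle s.X1
  have h2 : ∑ k, sizes s.X1 k < (bundle s.Xc none).card := hs
  have h3 : Disjoint (bundle s.Xc none) (bundle s.X1 none) := by
    refine Finset.disjoint_left.2 fun g hg hg1 => ?_
    exact h g (mem_bundle.1 hg) (mem_bundle.1 hg1)
  have h4 := Finset.card_le_univ (bundle s.Xc none ∪ bundle s.X1 none)
  rw [Finset.card_union_of_disjoint h3] at h4
  omega

theorem Invariant.init (hc : 2 ≤ c) (hv : ∀ i, IsBivaluedSubmodular 1 c (v i)) :
    Invariant c v d e (State.init : State G n) := by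
  have h0 : ∀ i : Fin n, bundle (fun _ => none : Allocation G n) (some i) = ∅ := by
    intro i
    ext g
    simp
  have hs : sizes (fun _ => none : Allocation G n) = 0 := by
    funext i
    simp [sizes, h0]
  refine ⟨fun k => ?_, by simp [State.init], fun i _ => congrFun hs i,
    fun i hi => absurd (Finset.mem_univ i) hi, hs.trans_le zero_le, hs.trans_le zero_le⟩
  cases k with
  | none => exact extBeta_none hc hv _
  | some i =>
    rw [State.init, h0, (isRankFunction_extBeta hc hv _).empty, Finset.card_empty]

theorem Invariant.step (hc : 2 ≤ c) (hv : ∀ i, IsBivaluedSubmodular 1 c (v i))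
    (hΨ : Ψ.SymmetricParetoDominance) (hφ : IsGainFunction Ψ c φ)
    (hb : IsBest Ψ c (cleanSizes c v) (Fintype.card G) d e) {s s' : State G n}
    (hs : Invariant c v d e s) (hstep : Step c v φ s s') : Invariant c v d e s' := by
  have hu : ∀ a, s.gain φ v a = fun k => φ (util c (sizes s.Xc) (sizes s.X1)) k a :=
    fun a => funext fun k => by rw [State.gain, hs.utility_eq hc hv]
  cases hstep with
  | augment hg hgain i hi P hP last hl X1' hX1 =>
    have hsz := hP.sizes_transfer
    have hmem : sizes s.Xc + Pi.single i 1 ∈ cleanSizes c v :=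
      ⟨_, hP.clean_transfer hc hv hs.clean, hsz⟩
    refine ⟨hP.clean_transfer hc hv hs.clean, ?_, fun k hk => ?_, fun k hk h => ?_, ?_, ?_⟩
    · have hne : ∀ g, g ≠ last → s.X1 g ≠ none → transfer s.Xc (some i) P g = none :=
        fun g hgl hg1 => (hP.transfer_eq_none_iff hl g).2 ⟨hs.supp g hg1, hgl⟩
      intro g hg1
      dsimp only at hg1 ⊢
      cases hX1 with
      | keep h => exact hne g (by rintro rfl; exact hg1 h) hg1
      | replace j h a hac ha1 =>
        by_cases hga : g = a
        · rw [hga, hac]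
        rw [Function.update_of_ne hga] at hg1
        by_cases hgl : g = last
        · subst hgl
          simp at hg1
        rw [Function.update_of_ne hgl] at hg1
        exact hne g hgl hg1
    · exact (congrFun hX1.sizes_eq k).trans (hs.active k hk)
    · refine hs.saturated k hk (cleanSizes_mono hc hv h ?_)
      rw [hsz]
      exact add_le_add_left le_self_add _
    · dsimp only
      rw [hsz]
      simp only [State.gainC, State.gainOne, hu] at hi hgain
      refine hb.add_single_le_left hc hv hΨ hφ hs.le_left hs.le_right hs.active hs.saturated hi
        (fun k hk => ?_) hmem hg.sum_lt
      rw [hi.maxGain_eq] at hgain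
      exact WithBot.coe_le_coe.1
        ((le_maxGain (Finset.mem_sdiff.2 ⟨Finset.mem_univ k, hk⟩)).trans hgain)
    · exact hX1.sizes_eq.trans_le hs.le_right
  | remove hg hgain i hi hP =>
    refine ⟨hs.clean, hs.supp, fun k hk => hs.active k (Finset.mem_of_mem_erase hk),
      fun k hk => ?_, hs.le_left, hs.le_right⟩
    by_cases hki : k = i
    · subst hki
      exact fun h => hP ((exists_path_iff hc hv hs.clean k).2 h)
    · exact hs.saturated k fun h => hk (Finset.mem_erase.2 ⟨hki, h⟩)
  | provisional hg hgain i hi g hgc hg1 =>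
    have hsz := sizes_update hg1 i
    refine ⟨hs.clean, fun x hx => ?_, fun k hk => ?_, hs.saturated, hs.le_left, ?_⟩
    · by_cases hxg : x = g
      · rw [hxg]
        exact hgc
      · dsimp only at hx
        rw [Function.update_of_ne hxg] at hx
        exact hs.supp x hx
    · have hki : k ≠ i := by
        rintro rfl
        exact (Finset.mem_sdiff.1 hi.1).2 hk
      dsimp only
      rw [hsz, Pi.add_apply, Pi.single_eq_of_ne hki, hs.active k hk, add_zero]
    · dsimp only
      rw [hsz]
      simp only [State.gainC, State.gainOne, hu] at hi hgain
      refine hb.add_single_le_right hc hv hΨ hφ hs.le_left hs.le_right hs.saturated hi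
        (fun k hk => ?_) hg.sum_lt
      rw [hi.maxGain_eq] at hgain
      exact WithBot.coe_lt_coe.1 ((le_maxGain hk).trans_lt hgain)

theorem exists_step (hn : 1 ≤ n) (s : State G n) (hg : s.Guard) : ∃ s', Step c v φ s s' := by
  obtain ⟨g, hgc, hg1⟩ := hg.exists_unallocated
  rcases le_or_gt (s.gainOne φ v) (s.gainC c φ v) with hgain | hgain
  · have hne : s.U.Nonempty := by
      by_contra h
      rw [Finset.not_nonempty_iff_eq_empty] at h
      have h1 := (le_maxGain (A := Finset.univ \ s.U) (f := s.gain φ v 1)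
        (k := ⟨0, hn⟩) (by simp [h])).trans hgain
      rw [State.gainC, h, maxGain, Finset.sup_empty] at h1
      exact absurd h1 (by simp)
    obtain ⟨i, hi⟩ := exists_isLeastArgmax (f := s.gain φ v c) hne
    by_cases hP : ∃ P, IsTransferPath c v s.Xc i P
    · obtain ⟨P, hP⟩ := exists_isShortestTransferPath hP
      obtain ⟨last, hl, -⟩ := hP.1.last_mem
      obtain ⟨X1', hX1⟩ : ∃ X1', Repair (transfer s.Xc (some i) P) last s.X1 X1' := by
        cases h : s.X1 last with
        | none => exact ⟨_, Repair.keep h⟩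
        | some j =>
          refine ⟨_, Repair.replace j h g ((hP.transfer_eq_none_iff hl g).2 ⟨hgc, ?_⟩) hg1⟩
          rintro rfl
          rw [hg1] at h
          exact absurd h (by simp)
      exact ⟨_, Step.augment s hg hgain i hi P hP last hl X1' hX1⟩
    · exact ⟨_, Step.remove s hg hgain i hi hP⟩
  · have hne : (Finset.univ \ s.U).Nonempty := by
      by_contra h
      rw [Finset.not_nonempty_iff_eq_empty] at h
      rw [State.gainOne, h, maxGain, Finset.sup_empty] at hgain
      exact not_lt_bot hgain
    obtain ⟨i, hi⟩ := exists_isLeastArgmax (f := s.gain φ v 1) hne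
    exact ⟨_, Step.provisional s hg hgain i hi g hgc hg1⟩

/-- The number of iterations that have led to the state `s`. -/
def State.potential (s : State G n) : ℕ :=
  ∑ k, sizes s.Xc k + ∑ k, sizes s.X1 k + s.Uᶜ.card

theorem Step.potential_eq {s s' : State G n} (h : Step c v φ s s') :
    s'.potential = s.potential + 1 := by
  cases h with
  | augment hg hgain i hi P hP last hl X1' hX1 =>
    simp only [State.potential, hX1.sizes_eq, hP.sizes_transfer, sum_add_single]
    omega
  | remove hg hgain i hi hP =>
    simp only [State.potential, Finset.compl_erase]
    rw [Finset.card_insert_of_notMem (by simpa using hi.1)]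
    omega
  | provisional hg hgain i hi g hgc hg1 =>
    simp only [State.potential, sizes_update hg1, sum_add_single]
    omega

theorem no_infinite_run :
    ¬ ∃ run : ℕ → State G n, run 0 = State.init ∧ ∀ t, Step c v φ (run t) (run (t + 1)) := by
  rintro ⟨run, -, hrun⟩
  have h : ∀ t, t ≤ (run t).potential := by
    intro t
    induction t with
    | zero => exact Nat.zero_le _
    | succ t ih =>
      rw [(hrun t).potential_eq]
      omega
  have hle : ∀ s : State G n, s.potential ≤ 2 * Fintype.card G + n := by
    intro s
    have h1 := sum_card_bundle s.Xc
    have h2 := sum_card_bundle s.X1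
    have h3 := Finset.card_le_univ s.Uᶜ
    rw [Fintype.card_fin] at h3
    unfold State.potential
    omega
  have h1 := h (2 * Fintype.card G + n + 1)
  have h2 := hle (run (2 * Fintype.card G + n + 1))
  omega

/-- The utility vector of an allocation comes from a feasible pair. -/
theorem exists_feasible_of_allocation (hc : 2 ≤ c) (hv : ∀ i, IsBivaluedSubmodular 1 c (v i))
    (Y : Allocation G n) : ∃ f : Fin n → ℕ,
      Feasible (cleanSizes c v) (Fintype.card G)
        (fun i => extBeta c v (some i) (bundle Y (some i))) f ∧
      utility v Y = util c (fun i => extBeta c v (some i) (bundle Y (some i))) f := by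
  have hle : ∀ i, extBeta c v (some i) (bundle Y (some i)) ≤ sizes Y i :=
    fun i => (isRankFunction_extBeta hc hv (some i)).le_card _
  refine ⟨fun i => sizes Y i - extBeta c v (some i) (bundle Y (some i)),
    ⟨extBeta_mem_cleanSizes hc hv Y, ?_⟩, funext fun i => ?_⟩
  · rw [← Finset.sum_add_distrib, Finset.sum_congr rfl fun i _ => Nat.add_sub_of_le (hle i)]
    exact (Nat.le_add_right _ _).trans_eq (sum_card_bundle Y)
  · rw [utility, val_eq hc hv]
    have h := Nat.add_sub_of_le (hle i)
    obtain ⟨k, rfl⟩ : ∃ k, c = k + 1 := ⟨c - 1, by omega⟩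
    simp only [util, Nat.add_sub_cancel, add_mul, one_mul]
    change sizes Y i + _ = _
    omega

theorem IsDecomposition.utility_eq (hc : 2 ≤ c) (hv : ∀ i, IsBivaluedSubmodular 1 c (v i))
    {X Xc X1 : Allocation G n} (h : IsDecomposition c v X Xc X1) :
    utility v Xc = util c (fun i => extBeta c v (some i) (bundle X (some i))) 0 := by
  funext i
  rw [utility, val_eq hc hv, h.clean (some i), h.card_eq]
  obtain ⟨k, rfl⟩ : ∃ k, c = k + 1 := ⟨c - 1, by omega⟩
  simp only [util, Nat.add_sub_cancel, Pi.zero_apply]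
  ring

theorem isDominatingMaximizing_of_isBest (hc : 2 ≤ c)
    (hv : ∀ i, IsBivaluedSubmodular 1 c (v i))
    (hb : IsBest Ψ c (cleanSizes c v) (Fintype.card G) d e) {X : Allocation G n}
    (hX : utility v X = util c d e)
    (hd : (fun i => extBeta c v (some i) (bundle X (some i))) = d) :
    IsDominatingMaximizing Ψ c v X := by
  refine ⟨fun Y hY => ?_, fun Y hY hdom => ?_⟩ <;>
    obtain ⟨f, hf, hu⟩ := exists_feasible_of_allocation hc hv Y
  · rw [hu, hX] at hY
    exact hY.2 (hb.2 _ _ hf hY.1).1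
  · have hge : Ψ.ge (utility v Y) (utility v X) := by
      by_contra h
      exact hY X ⟨(Ψ.total _ _).resolve_left h, h⟩
    rw [hu, hX] at hge
    refine (hb.2 _ _ hf hge).2 ?_
    obtain ⟨Yc, Y1, Xc, X1, hYd, hXd, h⟩ := hdom
    rwa [hYd.utility_eq hc hv, hXd.utility_eq hc hv, hd, hu, hX] at h

/-- When the loop ends, `(d, e)` is reached: the current pair lies below it and uses all goods. -/
theorem Invariant.isDominatingMaximizing (hc : 2 ≤ c)
    (hv : ∀ i, IsBivaluedSubmodular 1 c (v i))
    (hb : IsBest Ψ c (cleanSizes c v) (Fintype.card G) d e) {s : State G n}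
    (hs : Invariant c v d e s) (hg : ¬ s.Guard) : IsDominatingMaximizing Ψ c v s.alloc := by
  have h1 := sum_card_bundle s.Xc
  have h2 : (bundle s.Xc none).card ≤ ∑ k, sizes s.X1 k := not_lt.1 hg
  have h3 := hb.1.2
  have h4 := Finset.sum_le_sum fun k (_ : k ∈ Finset.univ) => hs.le_left k
  have h5 := Finset.sum_le_sum fun k (_ : k ∈ Finset.univ) => hs.le_right k
  have hd : sizes s.Xc = d := funext fun k =>
    (Finset.sum_eq_sum_iff_of_le fun k _ => hs.le_left k).1 (by omega) k (Finset.mem_univ k)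
  have he : sizes s.X1 = e := funext fun k =>
    (Finset.sum_eq_sum_iff_of_le fun k _ => hs.le_right k).1 (by omega) k (Finset.mem_univ k)
  have hu := hs.utility_eq hc hv
  rw [hd, he] at hu
  refine isDominatingMaximizing_of_isBest hc hv hb hu ?_
  rw [← hd]
  exact funext fun i => hs.extBeta_alloc hc hv i

end Runs

end BYS

theorem mainTheorem1 {G : Type*} [Fintype G] [DecidableEq G] (n : ℕ) (hn : 1 ≤ n)
    (c : ℕ) (hc : 2 ≤ c)
    (v : Fin n → Finset G → ℕ) (hv : ∀ i, BYS.IsBivaluedSubmodular 1 c (v i))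
    (Ψ : BYS.JusticeCriterion n) (hΨ : Ψ.SymmetricParetoDominance)
    (φ : (Fin n → ℕ) → Fin n → ℕ → ℝ) (hφ : BYS.IsGainFunction Ψ c φ) :
    BYS.AlwaysOutputs c v φ (fun X => BYS.IsDominatingMaximizing Ψ c v X) := by
  obtain ⟨d, e, hb⟩ := BYS.exists_isBest Ψ c (BYS.cleanSizes c v) (Fintype.card G)
    (BYS.zero_mem_cleanSizes hc hv)
  refine ⟨BYS.no_infinite_run, fun s _ hg => BYS.exists_step hn s hg, fun s hs hg => ?_⟩
  refine BYS.Invariant.isDominatingMaximizing hc hv hb ?_ hg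
  clear hg
  induction hs with
  | refl => exact BYS.Invariant.init hc hv
  | tail _ hstep ih => exact ih.step hc hv hΨ hφ hb hstep
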